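/- Let $\alpha\in\mathbb R$, $\alpha\neq-1$, and let $X_\alpha(t)$, $t\in[0,1]$, be a (jointly measurable) zero-mean Gaussian process whose covariance function $G(t,s)=\mathbb E X_\alpha(t)X_\alpha(s)$ is the Green function of the boundary value problem $$-u''=\lambda u\ \text{ on }[0,1],\qquad u(0)+\alpha u(1)=0,\qquad \alpha u'(0)+u'(1)=0,$$ that is, $G$ is continuous on $[0,1]^2$ and, for every $s\in(0,1)$, $G(\cdot,s)$ satisfies $-\partial_t^2G(t,s)=\delta(t-s)$ and the two boundary conditions. Then almost every sample path of $X_\alpha$ lies in $L_2(0,1)$. Let $\overline{X_\alpha}(t)=X_\alpha(t)-\int_0^1X_\alpha(s)\,ds$ be the demeaned process and $\|\cdot\|$ the norm of $L_2(0,1)$. 1. $\overline{X_\alpha}$ is a zero-mean Gaussian process, and for every $\alpha\ne-1$ its covariance function is the generalized Green function of the Neumann problem $$-u''=\lambda u\ \text{ on }[0,1],\qquad u'(0)=u'(1)=0.$$ Here the generalized Green function of a boundary value problem for $-u''$ whose zero eigenspace has the $L_2(0,1)$-orthonormal basis $\varphi_1,\dots,\varphi_m$ is the continuous kernel $K$ on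 $[0,1]^2$ such that $-\partial_t^2K(t,s)=\delta(t-s)-\sum_i\varphi_i(t)\varphi_i(s)$ and $K(\cdot,s)$ satisfies the boundary conditions for every $s\in(0,1)$, and $\int_0^1K(t,s)\varphi_i(t)\,dt=0$ for all $s\in[0,1]$ and all $i$. 2. If $W$ is a standard Wiener process and $\overline W(t)=W(t)-\int_0^1W(s)\,ds$ for $t\in[0,1]$, then $\|\overline{X_\alpha}\|$ and $\|\overline W\|$ have the same distribution; in particular $\mathbb P\{\|\overline{X_\alpha}\|\le\varepsilon\}=\mathbb P\{\|\overline W\|\le\varepsilon\}$ for every $\varepsilon$. 3. As $\varepsilon\to0+$, $$\mathbb P\big\{\|\overline{X_\alpha}\|\le\varepsilon\big\}\sim\Big(\frac8\pi\Big)^{1/2}\exp\Big(-\frac18\,\varepsilon^{-2}\Big).$$ -/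

import Mathlib

open MeasureTheory ProbabilityTheory Filter Topology Set

open scoped Asymptotics

noncomputable section

/-- A linear boundary form `a₀ u(0) + a₁ u(1) + b₀ u'(0) + b₁ u'(1)` on `[0,1]`. -/
structure BoundaryForm where
  a₀ : ℝ
  a₁ : ℝ
  b₀ : ℝ
  b₁ : ℝ

/-- Value of the form when `u(0), u(1), u'(0), u'(1)` are the four given numbers. -/
def BoundaryForm.eval (U : BoundaryForm) (u₀ u₁ du₀ du₁ : ℝ) : ℝ :=
  U.a₀ * u₀ + U.a₁ * u₁ + U.b₀ * du₀ + U.b₁ * du₁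

/-- The conditions `u(0) + α u(1) = 0`, `α u'(0) + u'(1) = 0`. -/
def twistedConditions (α : ℝ) : Fin 2 → BoundaryForm :=
  ![⟨1, α, 0, 0⟩, ⟨0, 0, α, 1⟩]

/-- The Neumann conditions `u'(0) = 0`, `u'(1) = 0`. -/
def neumannConditions : Fin 2 → BoundaryForm :=
  ![⟨0, 0, 1, 0⟩, ⟨0, 0, 0, 1⟩]

/-- `u` is a classical solution on `[0,1]` of `-u'' = 0` with the boundary conditions `U`. -/
structure IsNullSolution (U : Fin 2 → BoundaryForm) (u : ℝ → ℝ) : Prop where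
  contDiffOn : ContDiffOn ℝ 2 u (Icc 0 1)
  equation : ∀ t ∈ Icc (0 : ℝ) 1, -iteratedDerivWithin 2 u (Icc 0 1) t = 0
  boundary : ∀ ν, (U ν).eval (u 0) (u 1)
    (derivWithin u (Icc 0 1) 0) (derivWithin u (Icc 0 1) 1) = 0

/-- The kernel `G` on `[0,1]²` satisfies `-∂²G/∂t² (t,s) = δ(t - s) - r(t,s)` and, as a function
of `t`, the boundary conditions `U`, in the classical sense: `G` is continuous; for `0 < s < 1` the
function `G(·,s)` is `C²` up to the endpoints on each of `[0,s]` and `[s,1]`, where it solves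
`-u'' = -r(·,s)`; its derivative jumps by `-1` at `t = s`; and `G(·,s)` satisfies the boundary
conditions. -/
structure IsPointSourceKernel (U : Fin 2 → BoundaryForm) (r G : ℝ → ℝ → ℝ) : Prop where
  continuousOn : ContinuousOn (Function.uncurry G) (Icc 0 1 ×ˢ Icc 0 1)
  contDiffOn_left : ∀ s ∈ Ioo (0 : ℝ) 1, ContDiffOn ℝ 2 (fun t => G t s) (Icc 0 s)
  contDiffOn_right : ∀ s ∈ Ioo (0 : ℝ) 1, ContDiffOn ℝ 2 (fun t => G t s) (Icc s 1)
  equation_left : ∀ s ∈ Ioo (0 : ℝ) 1, ∀ t ∈ Icc 0 s,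
    -iteratedDerivWithin 2 (fun t => G t s) (Icc 0 s) t = -r t s
  equation_right : ∀ s ∈ Ioo (0 : ℝ) 1, ∀ t ∈ Icc s 1,
    -iteratedDerivWithin 2 (fun t => G t s) (Icc s 1) t = -r t s
  jump : ∀ s ∈ Ioo (0 : ℝ) 1,
    derivWithin (fun t => G t s) (Icc s 1) s - derivWithin (fun t => G t s) (Icc 0 s) s = -1
  boundary : ∀ s ∈ Ioo (0 : ℝ) 1, ∀ ν, (U ν).eval (G 0 s) (G 1 s)
    (derivWithin (fun t => G t s) (Icc 0 s) 0) (derivWithin (fun t => G t s) (Icc s 1) 1) = 0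

/-- `G` is the Green function of `-u''` on `[0,1]` with the boundary conditions `U`. -/
def IsGreenFunction (U : Fin 2 → BoundaryForm) (G : ℝ → ℝ → ℝ) : Prop :=
  IsPointSourceKernel U (fun _ _ => 0) G

/-- `φ` is an `L²(0,1)`-orthonormal basis of the space of solutions of `-u'' = 0` with the boundary
conditions `U`, that is, of the eigenspace for the eigenvalue zero. -/
structure IsNullBasis (U : Fin 2 → BoundaryForm) {m : ℕ} (φ : Fin m → ℝ → ℝ) : Prop where
  null : ∀ i, IsNullSolution U (φ i)
  orthonormal : ∀ i j, ∫ t in (0 : ℝ)..1, φ i t * φ j t = if i = j then 1 else 0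
  spans : ∀ u, IsNullSolution U u → ∃ c : Fin m → ℝ, ∀ t ∈ Icc (0 : ℝ) 1, u t = ∑ i, c i * φ i t

/-- `G` is the generalized Green function of `-u''` on `[0,1]` with the boundary conditions `U`:
`-∂²G/∂t² (t,s) = δ(t - s) - ∑ φ_i(t) φ_i(s)` with the conditions `U`, and `G(·,s)` is orthogonal
to every `φ_i`, where the `φ_i` are an orthonormal basis of the zero eigenspace. -/
def IsGeneralizedGreenFunction (U : Fin 2 → BoundaryForm) (G : ℝ → ℝ → ℝ) : Prop :=
  ∃ (m : ℕ) (φ : Fin m → ℝ → ℝ), IsNullBasis U φ ∧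
    IsPointSourceKernel U (fun t s => ∑ i, φ i t * φ i s) G ∧
    ∀ s ∈ Icc (0 : ℝ) 1, ∀ i, ∫ t in (0 : ℝ)..1, G t s * φ i t = 0

variable {Ω : Type*} [MeasurableSpace Ω]

/-- `X` is a zero-mean Gaussian process on `[0,1]`, measurable as a function of time and chance
jointly (up to null sets). Values `X t` with `t ∉ [0,1]` play no role. -/
structure IsCenteredGaussianOnUnit (X : ℝ → Ω → ℝ) (P : Measure Ω) : Prop where
  gaussian : IsGaussianProcess (fun t : Icc (0 : ℝ) 1 => X t) P
  mean_zero : ∀ t ∈ Icc (0 : ℝ) 1, ∫ ω, X t ω ∂P = 0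
  aemeasurable : AEMeasurable (Function.uncurry X) ((volume.restrict (Icc (0 : ℝ) 1)).prod P)

/-- `G_X(t,s) = E X(t) X(s)`. -/
def covKernel (X : ℝ → Ω → ℝ) (P : Measure Ω) (t s : ℝ) : ℝ :=
  ∫ ω, X t ω * X s ω ∂P

/-- The demeaned process `X(t) - ∫₀¹ X(s) ds`. -/
def demean (X : ℝ → Ω → ℝ) (t : ℝ) (ω : Ω) : ℝ :=
  X t ω - ∫ s in (0 : ℝ)..1, X s ω

/-- The `L²(0,1)` norm of the sample path. -/
def pathNorm (X : ℝ → Ω → ℝ) (ω : Ω) : ℝ :=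
  √(∫ t in (0 : ℝ)..1, X t ω ^ 2)

/-- Restriction of a process with time set `[0,∞)` to times in `[0,1]`. -/
def onUnit (W : NNReal → Ω → ℝ) (t : ℝ) (ω : Ω) : ℝ :=
  W t.toNNReal ω

end

/-! The twisted Green function is `min t s - c * (t + s) + c ^ 2` with `c = α / (1 + α)`.
Subtracting the path mean projects the covariance, in each variable, onto functions of mean zero.
Summands depending on one variable only are annihilated, and `α` disappears with them. What remains
is `neumannKernel`, which is also the covariance of the demeaned Wiener process (`c = 0`). Its
generalized Green property is read off from its two quadratic pieces. That demeaning preserves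
Gaussianity follows because path integrals lie in the closed `L²` span of the process, all of whose
elements are Gaussian.

For any centered Gaussian process `Y` with covariance `neumannKernel`, the coefficients along the
cosine eigenfunctions are independent centered Gaussians with variances `1 / (π (k + 1))²`. Euler's
product turns the product of their Laplace transforms into `√(θ / sinh θ)` at `θ² / 2`
(`integral_exp_neg_mul_sqNorm`). Completeness of the cosines is replaced by a trace computation: by
Bessel the partial sums of squared coefficients lie below the squared norm, and their expectations
tend to `1 / 6`, its expectation. Since a law on `[0, ∞)` is determined by its Laplace transform,
the equality in law follows.

For the small balls, division by `θ² / 2` passes from the transform of the law to that of its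
distribution function. With `q = exp (-2θ)`, the binomial series of `(1 - q)^(-1/2)` expands it into
nonnegative multiples of `θ^(-3/2) exp (-(2k + 1/2) θ)`, each inverted explicitly by `kernelTerm`.
The term `k = 0` carries the whole asymptotics: `b = 1/2` gives the exponent `b² / (2t) = 1 / (8t)`,
and `(2/π) √(2π) = √(8/π)` is the constant. Setting `t = ε²` finishes the argument. -/

/-! ### Green functions of the twisted and Neumann problems. -/

/-- A `C²` function on `[a, b]` with vanishing second derivative is affine. -/
lemma affine_of_iteratedDerivWithin_two_eq_zero {u : ℝ → ℝ} {a b : ℝ} (hab : a < b)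
    (hu : ContDiffOn ℝ 2 u (Icc a b))
    (h0 : ∀ t ∈ Icc a b, iteratedDerivWithin 2 u (Icc a b) t = 0) :
    ∃ p, ∀ t ∈ Icc a b, derivWithin u (Icc a b) t = p ∧ u t = u a + p * (t - a) := by
  have hU := uniqueDiffOn_Icc hab
  have hd : DifferentiableOn ℝ (derivWithin u (Icc a b)) (Icc a b) := by
    have : ContDiffOn ℝ 1 (derivWithin u (Icc a b)) (Icc a b) :=
      hu.derivWithin hU (by norm_num)
    exact this.differentiableOn (by norm_num)
  have hc := constant_of_derivWithin_zero hd (fun x hx => by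
    have := h0 x (Ico_subset_Icc_self hx)
    rw [iteratedDerivWithin_succ, iteratedDerivWithin_one] at this
    exact this)
  have hud : DifferentiableOn ℝ u (Icc a b) := hu.differentiableOn (by norm_num)
  refine ⟨derivWithin u (Icc a b) a, fun t ht => ⟨hc t ht, ?_⟩⟩
  set p := derivWithin u (Icc a b) a
  have hv := constant_of_derivWithin_zero (f := fun t => u t - p * (t - a)) (a := a) (b := b)
    (hud.sub (by fun_prop)) (fun x hx => by
      have h1 : HasDerivWithinAt u p (Icc a b) x := by
        rw [← hc x (Ico_subset_Icc_self hx)]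
        exact (hud x (Ico_subset_Icc_self hx)).hasDerivWithinAt
      have h2 : HasDerivWithinAt (fun t => p * (t - a)) p (Icc a b) x := by
        simpa using (((hasDerivAt_id x).sub_const a).const_mul p).hasDerivWithinAt
      have h3 : HasDerivWithinAt (fun t => u t - p * (t - a)) (p - p) (Icc a b) x := h1.sub h2
      rw [h3.derivWithin (hU x (Ico_subset_Icc_self hx)), sub_self])
  have := hv t ht
  simp only [sub_self, mul_zero, sub_zero] at this
  linarith

/-- The Green function of the twisted problem in closed form. -/
lemma IsGreenFunction.twisted_eq {α : ℝ} (hα : α ≠ -1) {G : ℝ → ℝ → ℝ}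
    (hG : IsGreenFunction (twistedConditions α) G) :
    ∀ t ∈ Icc (0 : ℝ) 1, ∀ s ∈ Icc (0 : ℝ) 1,
      G t s = min t s - α / (1 + α) * (t + s) + (α / (1 + α)) ^ 2 := by
  have hα' : 1 + α ≠ 0 := fun h => hα (by linarith)
  have inner : ∀ s ∈ Ioo (0 : ℝ) 1, ∀ t ∈ Icc (0 : ℝ) 1,
      G t s = min t s - α / (1 + α) * (t + s) + (α / (1 + α)) ^ 2 := by
    intro s hs t ht
    obtain ⟨p, hp⟩ := affine_of_iteratedDerivWithin_two_eq_zero hs.1 (hG.contDiffOn_left s hs)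
      (fun t ht => by simpa using hG.equation_left s hs t ht)
    obtain ⟨q, hq⟩ := affine_of_iteratedDerivWithin_two_eq_zero hs.2 (hG.contDiffOn_right s hs)
      (fun t ht => by simpa using hG.equation_right s hs t ht)
    have h0 := hp 0 ⟨le_rfl, hs.1.le⟩
    have hls := hp s ⟨hs.1.le, le_rfl⟩
    have hrs := hq s ⟨le_rfl, hs.2.le⟩
    have h1 := hq 1 ⟨hs.2.le, le_rfl⟩
    have hj := hG.jump s hs
    have hb0 := hG.boundary s hs 0
    have hb1 := hG.boundary s hs 1
    simp only [twistedConditions, BoundaryForm.eval, Matrix.cons_val_zero, Matrix.cons_val_one,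
      h0.1, h1.1] at hb0 hb1
    rw [hls.1, hrs.1] at hj
    -- The jump `q - p = -1` and the condition `α p + q = 0` determine both slopes; this is where `α
    -- ≠ -1` enters.
    have hpe : p = 1 / (1 + α) := by
      field_simp; linear_combination hb1 - hj
    have hqe : q = p - 1 := by linarith
    have hGs := hls.2
    have hG1 := h1.2
    have hG0 : G 0 s = α / (1 + α) * (α / (1 + α) - s) := by
      have : (1 + α) * G 0 s = α * (α / (1 + α) - s) := by
        have e : α / (1 + α) = 1 - p := by rw [hpe]; field_simp; ring
        rw [e]
        linear_combination hb0 - α * hG1 - α * hGs - α * (1 - s) * hqe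
      field_simp at this ⊢
      linear_combination this
    rcases le_total t s with h | h
    · rw [min_eq_left h, (hp t ⟨ht.1, h⟩).2, hG0, hpe]
      field_simp; ring
    · rw [min_eq_right h, (hq t ⟨h, ht.2⟩).2, hGs, hG0, hqe, hpe]
      field_simp; ring
  -- The Green property speaks only of `0 < s < 1`; the edges `s = 0` and `s = 1` are reached by
  -- continuity.
  intro t ht s hs
  have hc1 : ContinuousOn (fun s => G t s) (Icc 0 1) :=
    hG.continuousOn.comp (f := fun s => (t, s)) (by fun_prop) (fun s hs => ⟨ht, hs⟩)
  have hc2 : ContinuousOn (fun s => min t s - α / (1 + α) * (t + s) + (α / (1 + α)) ^ 2)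
    (Icc (0 : ℝ) 1) := by fun_prop
  have heq : EqOn (fun s => G t s) (fun s => min t s - α / (1 + α) * (t + s) + (α / (1 + α)) ^ 2)
    (Ioo 0 1) := fun s hs => inner s hs t ht
  exact heq.of_subset_closure hc1 hc2 Ioo_subset_Icc_self
    (by rw [closure_Ioo (by norm_num)]) hs

/-- The covariance function of the demeaned Wiener process. -/
noncomputable def neumannKernel (t s : ℝ) : ℝ := min t s - (t - t ^ 2 / 2) - (s - s ^ 2 / 2) + 1 / 3

lemma continuous_neumannKernel : Continuous (Function.uncurry neumannKernel) := by
  unfold neumannKernel Function.uncurry; fun_prop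

/-- Kernels built from `min` have one explicit formula on each side of the diagonal, so their
integrals are split there. -/
lemma intervalIntegral_split_min {f g h : ℝ → ℝ} {s : ℝ} (hs : s ∈ Icc (0 : ℝ) 1)
    (hg : Continuous g) (hh : Continuous h) (h1 : ∀ r ∈ Icc 0 s, f r = g r)
    (h2 : ∀ r ∈ Icc s 1, f r = h r) :
    ∫ r in (0 : ℝ)..1, f r = (∫ r in (0 : ℝ)..s, g r) + ∫ r in s..1, h r := by
  have e1 : ∫ r in (0 : ℝ)..s, f r = ∫ r in (0 : ℝ)..s, g r :=
    intervalIntegral.integral_congr (fun r hr => h1 r (by rwa [uIcc_of_le hs.1] at hr))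
  have e2 : ∫ r in s..1, f r = ∫ r in s..1, h r :=
    intervalIntegral.integral_congr (fun r hr => h2 r (by rwa [uIcc_of_le hs.2] at hr))
  rw [← e1, ← e2, intervalIntegral.integral_add_adjacent_intervals]
  · refine (intervalIntegrable_congr_uIoo ?_).2 (hg.intervalIntegrable 0 s)
    intro r hr
    rw [uIoo_of_le hs.1] at hr
    exact h1 r (Ioo_subset_Icc_self hr)
  · refine (intervalIntegrable_congr_uIoo ?_).2 (hh.intervalIntegrable s 1)
    intro r hr
    rw [uIoo_of_le hs.2] at hr
    exact h2 r (Ioo_subset_Icc_self hr)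

lemma integral_min {s : ℝ} (hs : s ∈ Icc (0 : ℝ) 1) :
    ∫ r in (0 : ℝ)..1, min s r = s - s ^ 2 / 2 := by
  rw [intervalIntegral_split_min hs (g := fun r => r) (h := fun _ => s) (by fun_prop)
    (by fun_prop) (fun r hr => min_eq_right hr.2) (fun r hr => min_eq_left hr.1)]
  simp
  ring

lemma integral_neumannKernel {s : ℝ} (hs : s ∈ Icc (0 : ℝ) 1) :
    ∫ t in (0 : ℝ)..1, neumannKernel t s = 0 := by
  have : ∀ t, neumannKernel t s = min s t - (t - t ^ 2 / 2) + (1 / 3 - (s - s ^ 2 / 2)) := by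
    intro t; unfold neumannKernel; rw [min_comm]; ring
  simp_rw [this]
  rw [intervalIntegral.integral_add, intervalIntegral.integral_sub, integral_min hs,
    intervalIntegral.integral_sub, intervalIntegral.integral_div]
  · simp
    ring
  all_goals exact Continuous.intervalIntegrable (by fun_prop) _ _

lemma integral_neumannKernel_diag : ∫ t in (0 : ℝ)..1, neumannKernel t t = 1 / 6 := by
  have : ∀ t, neumannKernel t t = t ^ 2 - t + 1 / 3 := by
    intro t; unfold neumannKernel; rw [min_self]; ring
  simp_rw [this]
  rw [intervalIntegral.integral_add, intervalIntegral.integral_sub]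
  · simp
    norm_num
  all_goals exact Continuous.intervalIntegrable (by fun_prop) _ _

lemma hasDerivAt_quadratic (a b t : ℝ) :
    HasDerivAt (fun t : ℝ => t ^ 2 / 2 + a * t + b) (t + a) t := by
  have h1 := ((hasDerivAt_id t).pow 2).div_const 2
  have h2 := (hasDerivAt_id t).const_mul a
  refine ((h1.add h2).add_const b).congr_deriv ?_
  simp

lemma IsPointSourceKernel.congr {U : Fin 2 → BoundaryForm} {r G G' : ℝ → ℝ → ℝ}
    (hG : IsPointSourceKernel U r G)
    (h : ∀ t ∈ Icc (0 : ℝ) 1, ∀ s ∈ Icc (0 : ℝ) 1, G' t s = G t s) :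
    IsPointSourceKernel U r G' := by
  have hl : ∀ s ∈ Ioo (0 : ℝ) 1, EqOn (fun t => G' t s) (fun t => G t s) (Icc 0 s) :=
    fun s hs t ht => h t ⟨ht.1, ht.2.trans hs.2.le⟩ s ⟨hs.1.le, hs.2.le⟩
  have hr : ∀ s ∈ Ioo (0 : ℝ) 1, EqOn (fun t => G' t s) (fun t => G t s) (Icc s 1) :=
    fun s hs t ht => h t ⟨hs.1.le.trans ht.1, ht.2⟩ s ⟨hs.1.le, hs.2.le⟩
  refine ⟨?_, ?_, ?_, ?_, ?_, ?_, ?_⟩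
  · exact hG.continuousOn.congr (fun x hx => h x.1 hx.1 x.2 hx.2)
  · exact fun s hs => (hG.contDiffOn_left s hs).congr (hl s hs)
  · exact fun s hs => (hG.contDiffOn_right s hs).congr (hr s hs)
  · intro s hs t ht
    rw [iteratedDerivWithin_congr (hl s hs) ht]
    exact hG.equation_left s hs t ht
  · intro s hs t ht
    rw [iteratedDerivWithin_congr (hr s hs) ht]
    exact hG.equation_right s hs t ht
  · intro s hs
    rw [derivWithin_congr (hl s hs) (hl s hs ⟨hs.1.le, le_rfl⟩),
      derivWithin_congr (hr s hs) (hr s hs ⟨le_rfl, hs.2.le⟩)]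
    exact hG.jump s hs
  · intro s hs ν
    rw [derivWithin_congr (hl s hs) (hl s hs ⟨le_rfl, hs.1.le⟩),
      derivWithin_congr (hr s hs) (hr s hs ⟨hs.2.le, le_rfl⟩),
      h 0 ⟨le_rfl, by norm_num⟩ s ⟨hs.1.le, hs.2.le⟩,
      h 1 ⟨by norm_num, le_rfl⟩ s ⟨hs.1.le, hs.2.le⟩]
    exact hG.boundary s hs ν

/-- Derivatives of a function that coincides with a monic quadratic (halved) on an interval. -/
lemma quadratic_piece {f : ℝ → ℝ} {a b x y : ℝ} (hxy : x < y)
    (h : EqOn f (fun t => t ^ 2 / 2 + a * t + b) (Icc x y)) :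
    ContDiffOn ℝ 2 f (Icc x y) ∧ (∀ t ∈ Icc x y, derivWithin f (Icc x y) t = t + a) ∧
      ∀ t ∈ Icc x y, iteratedDerivWithin 2 f (Icc x y) t = 1 := by
  have hU := uniqueDiffOn_Icc hxy
  have hd : ∀ t ∈ Icc x y, derivWithin f (Icc x y) t = t + a := by
    intro t ht
    rw [derivWithin_congr h (h ht)]
    exact (hasDerivAt_quadratic a b t).hasDerivWithinAt.derivWithin (hU t ht)
  refine ⟨?_, hd, ?_⟩
  · refine ContDiffOn.congr ?_ h
    exact ContDiff.contDiffOn (by fun_prop)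
  · intro t ht
    rw [iteratedDerivWithin_succ, iteratedDerivWithin_one, derivWithin_congr hd (hd t ht)]
    exact ((hasDerivAt_id t).add_const a).hasDerivWithinAt.derivWithin (hU t ht)

/-- In `t` the kernel is `t² / 2` plus an affine function, with slope `t` to the left of `s` and `t
- 1` to the right. Hence the jump is `-1`, and the slopes at the endpoints `0` and `1` vanish. -/
lemma isPointSourceKernel_neumannKernel :
    IsPointSourceKernel neumannConditions (fun _ _ => 1) neumannKernel := by
  have hl : ∀ s ∈ Ioo (0 : ℝ) 1, EqOn (fun t => neumannKernel t s)
      (fun t => t ^ 2 / 2 + 0 * t + (1 / 3 - (s - s ^ 2 / 2))) (Icc 0 s) := by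
    intro s hs t ht
    simp only [neumannKernel, min_eq_left ht.2]; ring
  have hr : ∀ s ∈ Ioo (0 : ℝ) 1, EqOn (fun t => neumannKernel t s)
      (fun t => t ^ 2 / 2 + (-1) * t + (1 / 3 + s ^ 2 / 2)) (Icc s 1) := by
    intro s hs t ht
    simp only [neumannKernel, min_eq_right ht.1]; ring
  refine ⟨continuous_neumannKernel.continuousOn, ?_, ?_, ?_, ?_, ?_, ?_⟩
  · exact fun s hs => (quadratic_piece hs.1 (hl s hs)).1
  · exact fun s hs => (quadratic_piece hs.2 (hr s hs)).1
  · exact fun s hs t ht => by rw [(quadratic_piece hs.1 (hl s hs)).2.2 t ht]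
  · exact fun s hs t ht => by rw [(quadratic_piece hs.2 (hr s hs)).2.2 t ht]
  · intro s hs
    rw [(quadratic_piece hs.1 (hl s hs)).2.1 s ⟨hs.1.le, le_rfl⟩,
      (quadratic_piece hs.2 (hr s hs)).2.1 s ⟨le_rfl, hs.2.le⟩]
    ring
  · intro s hs ν
    rw [(quadratic_piece hs.1 (hl s hs)).2.1 0 ⟨le_rfl, hs.1.le⟩,
      (quadratic_piece hs.2 (hr s hs)).2.1 1 ⟨hs.2.le, le_rfl⟩]
    fin_cases ν <;> simp [neumannConditions, BoundaryForm.eval]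

/-- The zero eigenspace of the Neumann problem consists of the constants. -/
lemma isNullBasis_neumann : IsNullBasis neumannConditions (fun (_ : Fin 1) (_ : ℝ) => (1 : ℝ)) := by
  refine ⟨fun _ => ⟨contDiffOn_const, ?_, ?_⟩, ?_, ?_⟩
  · intro t ht
    simp [iteratedDerivWithin_const]
  · intro ν
    fin_cases ν <;> simp [neumannConditions, BoundaryForm.eval]
  · intro i j
    simp [Subsingleton.elim i j]
  · intro u hu
    obtain ⟨p, hp⟩ := affine_of_iteratedDerivWithin_two_eq_zero zero_lt_one hu.contDiffOn
      (fun t ht => by simpa using hu.equation t ht)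
    have h0 := hu.boundary 0
    simp only [neumannConditions, BoundaryForm.eval, Matrix.cons_val_zero] at h0
    rw [(hp 0 ⟨le_rfl, zero_le_one⟩).1] at h0
    refine ⟨fun _ => u 0, fun t ht => ?_⟩
    rw [(hp t ht).2]
    simp only [Finset.univ_unique, Finset.sum_singleton]
    linear_combination t * h0

lemma isGeneralizedGreenFunction_neumann {G : ℝ → ℝ → ℝ}
    (h : ∀ t ∈ Icc (0 : ℝ) 1, ∀ s ∈ Icc (0 : ℝ) 1, G t s = neumannKernel t s) :
    IsGeneralizedGreenFunction neumannConditions G := by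
  refine ⟨1, fun _ _ => 1, isNullBasis_neumann, ?_, fun s hs _ => ?_⟩
  · simpa using isPointSourceKernel_neumannKernel.congr h
  · refine (intervalIntegral.integral_congr (fun t ht => ?_)).trans (integral_neumannKernel hs)
    rw [uIcc_of_le zero_le_one] at ht
    simp [h t ht s hs]

/-! ### Cosine eigenfunctions of the Neumann kernel. -/

/-- The normalized eigenfunctions `√2 cos(π(k+1)t)` of the Neumann problem. -/
noncomputable def cosBasis (k : ℕ) (t : ℝ) : ℝ := √2 * Real.cos (Real.pi * (k + 1) * t)

lemma continuous_cosBasis (k : ℕ) : Continuous (cosBasis k) := by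
  unfold cosBasis; fun_prop

lemma integral_cos_pi_int_mul {n : ℤ} (hn : n ≠ 0) :
    ∫ t in (0 : ℝ)..1, Real.cos (Real.pi * n * t) = 0 := by
  have h : Real.pi * n ≠ 0 := mul_ne_zero Real.pi_ne_zero (by exact_mod_cast hn)
  rw [intervalIntegral.integral_comp_mul_left _ h]
  simp [mul_comm Real.pi, Real.sin_int_mul_pi]

lemma integral_cosBasis_mul (j k : ℕ) :
    ∫ t in (0 : ℝ)..1, cosBasis j t * cosBasis k t = if j = k then 1 else 0 := by
  have h : ∀ t, cosBasis j t * cosBasis k t =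
      Real.cos (Real.pi * ((j - k : ℤ) : ℝ) * t) + Real.cos (Real.pi * ((j + k + 2 : ℤ) : ℝ) * t) := by
    intro t
    unfold cosBasis
    have e1 : Real.pi * ((j - k : ℤ) : ℝ) * t =
        Real.pi * (j + 1) * t - Real.pi * (k + 1) * t := by push_cast; ring
    have e2 : Real.pi * ((j + k + 2 : ℤ) : ℝ) * t =
        Real.pi * (j + 1) * t + Real.pi * (k + 1) * t := by push_cast; ring
    rw [e1, e2, Real.cos_sub, Real.cos_add]
    linear_combination (Real.cos (Real.pi * (j + 1) * t) * Real.cos (Real.pi * (k + 1) * t)) *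
      Real.mul_self_sqrt (zero_le_two (α := ℝ))
  simp_rw [h]
  rw [intervalIntegral.integral_add (Continuous.intervalIntegrable (by fun_prop) _ _)
    (Continuous.intervalIntegrable (by fun_prop) _ _),
    integral_cos_pi_int_mul (n := j + k + 2) (by omega)]
  split_ifs with hjk
  · simp [hjk]
  · rw [integral_cos_pi_int_mul (by omega), add_zero]

/-- The antiderivative arises from repeated integration by parts, which stops because the quadratic
has constant second derivative; each integration of the trigonometric factor contributes a factor `1
/ w`. -/
lemma hasDerivAt_quadratic_mul_cos {w : ℝ} (hw : w ≠ 0) (a b r : ℝ) :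
    HasDerivAt (fun r => (r ^ 2 / 2 + a * r + b) * Real.sin (w * r) / w +
      (r + a) * Real.cos (w * r) / w ^ 2 - Real.sin (w * r) / w ^ 3)
      ((r ^ 2 / 2 + a * r + b) * Real.cos (w * r)) r := by
  have hs : HasDerivAt (fun r => Real.sin (w * r)) (Real.cos (w * r) * w) r := by
    simpa using ((hasDerivAt_id r).const_mul w).sin
  have hc : HasDerivAt (fun r => Real.cos (w * r)) (-Real.sin (w * r) * w) r := by
    simpa using ((hasDerivAt_id r).const_mul w).cos
  have hq : HasDerivAt (fun r : ℝ => r ^ 2 / 2 + a * r + b) (r + a) r :=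
    hasDerivAt_quadratic a b r
  have hl : HasDerivAt (fun r : ℝ => r + a) 1 r := (hasDerivAt_id r).add_const a
  refine ((((hq.mul hs).div_const w).add ((hl.mul hc).div_const (w ^ 2))).sub
    (hs.div_const (w ^ 3))).congr_deriv ?_
  field_simp
  ring

lemma integral_quadratic_mul_cos {w : ℝ} (hw : w ≠ 0) (a b x y : ℝ) :
    ∫ r in x..y, (r ^ 2 / 2 + a * r + b) * Real.cos (w * r) =
      ((y ^ 2 / 2 + a * y + b) * Real.sin (w * y) / w +
        (y + a) * Real.cos (w * y) / w ^ 2 - Real.sin (w * y) / w ^ 3) -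
      ((x ^ 2 / 2 + a * x + b) * Real.sin (w * x) / w +
        (x + a) * Real.cos (w * x) / w ^ 2 - Real.sin (w * x) / w ^ 3) :=
  intervalIntegral.integral_eq_sub_of_hasDerivAt
    (fun r _ => hasDerivAt_quadratic_mul_cos hw a b r)
    (Continuous.intervalIntegrable (by fun_prop) _ _)

/-- `cosBasis k` is an eigenfunction of the integral operator with kernel `neumannKernel`. -/
lemma integral_neumannKernel_mul_cosBasis (k : ℕ) {s : ℝ} (hs : s ∈ Icc (0 : ℝ) 1) :
    ∫ r in (0 : ℝ)..1, cosBasis k r * neumannKernel s r =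
      cosBasis k s / (Real.pi * (k + 1)) ^ 2 := by
  have hw : Real.pi * ((k : ℝ) + 1) ≠ 0 := mul_ne_zero Real.pi_ne_zero (by positivity)
  have hsin : Real.sin (Real.pi * ((k : ℝ) + 1) * 1) = 0 := by
    have := Real.sin_nat_mul_pi (k + 1)
    push_cast at this
    rw [mul_one, mul_comm, this]
  unfold cosBasis
  set w := Real.pi * ((k : ℝ) + 1)
  have hsplit := intervalIntegral_split_min hs
    (f := fun r => √2 * Real.cos (w * r) * neumannKernel s r)
    (g := fun r => √2 * ((r ^ 2 / 2 + 0 * r + (1 / 3 - (s - s ^ 2 / 2))) * Real.cos (w * r)))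
    (h := fun r => √2 * ((r ^ 2 / 2 + (-1) * r + (1 / 3 + s ^ 2 / 2)) * Real.cos (w * r)))
    (by fun_prop) (by fun_prop)
    (fun r hr => by simp only [neumannKernel, min_eq_right hr.2]; ring)
    (fun r hr => by simp only [neumannKernel, min_eq_left hr.1]; ring)
  rw [hsplit, intervalIntegral.integral_const_mul, intervalIntegral.integral_const_mul,
    integral_quadratic_mul_cos hw, integral_quadratic_mul_cos hw, hsin]
  simp only [mul_zero, Real.sin_zero, Real.cos_zero]
  field_simp
  ring

/-! ### Closed Gaussian subspaces of `L²`. -/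

section GaussianSubspace

variable {Ω : Type*} [MeasurableSpace Ω] {P : Measure Ω}

lemma inner_toLp_eq_integral {f g : Ω → ℝ} (hf : MemLp f 2 P) (hg : MemLp g 2 P) :
    inner ℝ (hf.toLp f) (hg.toLp g) = ∫ ω, f ω * g ω ∂P := by
  rw [L2.inner_def]
  refine integral_congr_ae ?_
  filter_upwards [hf.coeFn_toLp, hg.coeFn_toLp] with ω h1 h2
  rw [h1, h2]
  simp [mul_comm]

lemma norm_toLp_sq_eq_integral {f : Ω → ℝ} (hf : MemLp f 2 P) :
    ‖hf.toLp f‖ ^ 2 = ∫ ω, f ω ^ 2 ∂P := by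
  rw [← real_inner_self_eq_norm_sq, inner_toLp_eq_integral]
  simp_rw [pow_two]

lemma toLp_finsetSum {ι : Type*} (s : Finset ι) (c : ι → ℝ) {Z : ι → Ω → ℝ}
    (hZ : ∀ i, MemLp (Z i) 2 P) (h : MemLp (fun ω => ∑ i ∈ s, c i * Z i ω) 2 P) :
    h.toLp _ = ∑ i ∈ s, c i • (hZ i).toLp (Z i) := by
  refine Lp.ext (h.coeFn_toLp.trans ?_)
  refine EventuallyEq.trans ?_ (Lp.coeFn_finsetSum s _).symm
  have h1 : ∀ i ∈ s, ∀ᵐ ω ∂P, (c i • (hZ i).toLp (Z i) : Lp ℝ 2 P) ω = c i * Z i ω := by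
    intro i _
    filter_upwards [Lp.coeFn_smul (c i) ((hZ i).toLp (Z i)), (hZ i).coeFn_toLp] with ω h1 h2
    rw [h1, Pi.smul_apply, h2, smul_eq_mul]
  filter_upwards [(Finset.eventually_all s).2 h1] with ω hω
  rw [Finset.sum_apply]
  exact (Finset.sum_congr rfl hω).symm

lemma norm_exp_mul_I_sub_exp_mul_I_le (a b : ℝ) :
    ‖Complex.exp (a * Complex.I) - Complex.exp (b * Complex.I)‖ ≤ |a - b| := by
  have : Complex.exp (a * Complex.I) - Complex.exp (b * Complex.I) =
      Complex.exp (b * Complex.I) * (Complex.exp (Complex.I * ((a - b : ℝ) : ℂ)) - 1) := by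
    rw [mul_sub, ← Complex.exp_add, mul_one]
    congr 2
    push_cast
    ring
  rw [this, norm_mul, Complex.norm_exp_ofReal_mul_I, one_mul]
  exact Real.norm_exp_I_mul_ofReal_sub_one_le

/-- A subspace of `L²` all of whose elements are centered Gaussian random variables. -/
def IsGaussianSubspace (H : Submodule ℝ (Lp ℝ 2 P)) : Prop :=
  ∀ f ∈ H, ∫ ω, Complex.exp (f ω * Complex.I) ∂P = Complex.exp (-((‖f‖ ^ 2 / 2 : ℝ) : ℂ))

lemma integrable_exp_mul_I [IsFiniteMeasure P] {f : Ω → ℝ} (hf : AEStronglyMeasurable f P) :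
    Integrable (fun ω => Complex.exp (f ω * Complex.I)) P := by
  refine Integrable.of_bound (C := 1) ?_ (ae_of_all _ fun ω => ?_)
  · exact (Complex.continuous_exp.comp_aestronglyMeasurable
      ((Complex.continuous_ofReal.comp_aestronglyMeasurable hf).mul_const _))
  · rw [Complex.norm_exp_ofReal_mul_I]

/-- The map `x ↦ exp (i x)` is 1-Lipschitz, and on a probability space the `L¹` norm is at most the
`L²` norm. This continuity lets Gaussianity pass to `L²` limits. -/
lemma continuous_integral_exp_mul_I [IsProbabilityMeasure P] :
    Continuous (fun f : Lp ℝ 2 P => ∫ ω, Complex.exp (f ω * Complex.I) ∂P) := by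
  refine LipschitzWith.continuous (K := 1) (LipschitzWith.of_dist_le_mul fun f g => ?_)
  rw [NNReal.coe_one, one_mul, dist_eq_norm, dist_eq_norm,
    ← integral_sub (integrable_exp_mul_I (Lp.aestronglyMeasurable f))
      (integrable_exp_mul_I (Lp.aestronglyMeasurable g))]
  refine (norm_integral_le_integral_norm _).trans ?_
  have hi : Integrable (fun ω => |(f - g : Lp ℝ 2 P) ω|) P :=
    ((Lp.memLp (f - g)).integrable (by norm_num)).abs
  have h1 : ∫ ω, ‖Complex.exp (f ω * Complex.I) - Complex.exp (g ω * Complex.I)‖ ∂P ≤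
      ∫ ω, |(f - g : Lp ℝ 2 P) ω| ∂P := by
    refine integral_mono_ae ?_ hi ?_
    · exact ((integrable_exp_mul_I (Lp.aestronglyMeasurable f)).sub
        (integrable_exp_mul_I (Lp.aestronglyMeasurable g))).norm
    · filter_upwards [Lp.coeFn_sub f g] with ω hω
      rw [hω]
      exact norm_exp_mul_I_sub_exp_mul_I_le _ _
  refine h1.trans ?_
  have h2 : ∫ ω, |(f - g : Lp ℝ 2 P) ω| ∂P = (eLpNorm (f - g : Lp ℝ 2 P) 1 P).toReal := by
    rw [eLpNorm_one_eq_lintegral_enorm, ← integral_norm_eq_lintegral_enorm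
      (Lp.aestronglyMeasurable _)]
    simp
  rw [h2, Lp.norm_def]
  exact ENNReal.toReal_mono (Lp.eLpNorm_ne_top _)
    (eLpNorm_le_eLpNorm_of_exponent_le (by norm_num) (Lp.aestronglyMeasurable _))

lemma IsGaussianSubspace.topologicalClosure [IsProbabilityMeasure P]
    {H : Submodule ℝ (Lp ℝ 2 P)} (hH : IsGaussianSubspace H) :
    IsGaussianSubspace H.topologicalClosure := by
  have hc : IsClosed {f : Lp ℝ 2 P | ∫ ω, Complex.exp (f ω * Complex.I) ∂P =
      Complex.exp (-((‖f‖ ^ 2 / 2 : ℝ) : ℂ))} :=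
    isClosed_eq continuous_integral_exp_mul_I (by fun_prop)
  intro f hf
  exact closure_minimal (s := (H : Set (Lp ℝ 2 P))) hH hc hf

lemma IsGaussianSubspace.integral_exp {H : Submodule ℝ (Lp ℝ 2 P)} (hH : IsGaussianSubspace H)
    {f : Ω → ℝ} (hf : MemLp f 2 P) (hfH : hf.toLp f ∈ H) :
    ∫ ω, Complex.exp (f ω * Complex.I) ∂P =
      Complex.exp (-(((∫ ω, f ω ^ 2 ∂P) / 2 : ℝ) : ℂ)) := by
  rw [← norm_toLp_sq_eq_integral hf, ← hH _ hfH]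
  refine integral_congr_ae ?_
  filter_upwards [hf.coeFn_toLp] with ω hω
  rw [hω]

/-- A centered family in a Gaussian subspace is jointly Gaussian. -/
lemma IsGaussianSubspace.isGaussianProcess [IsProbabilityMeasure P] {H : Submodule ℝ (Lp ℝ 2 P)}
    (hH : IsGaussianSubspace H) {T : Type*} {Z : T → Ω → ℝ} (hZ : ∀ t, MemLp (Z t) 2 P)
    (hZH : ∀ t, (hZ t).toLp (Z t) ∈ H) (h0 : ∀ t, ∫ ω, Z t ω ∂P = 0) :
    IsGaussianProcess Z P := by
  classical
  refine ⟨fun I => ?_⟩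
  have hm : AEMeasurable (fun ω => I.restrict (Z · ω)) P :=
    aemeasurable_pi_lambda _ fun i => (hZ i).aestronglyMeasurable.aemeasurable
  -- `IsGaussianSubspace` records the characteristic function at frequency one only. That suffices,
  -- since each linear functional `L` of finitely many `Z t` is again an element of the subspace.
  refine (hasGaussianLaw_iff_charFunDual_map_eq hm).2 fun L => ?_
  have hL : ∀ ω, L (I.restrict (Z · ω)) = ∑ i : I, L (Pi.single i 1) * Z i ω := by
    intro ω
    have := LinearMap.pi_apply_eq_sum_univ (L : (I → ℝ) →ₗ[ℝ] ℝ) (I.restrict (Z · ω))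
    simp only [ContinuousLinearMap.coe_coe] at this
    rw [this]
    refine Finset.sum_congr rfl fun i _ => ?_
    rw [smul_eq_mul, mul_comm]
    simp only [Finset.restrict]
    congr 2
    ext j
    simp [Pi.single_apply, eq_comm]
  have hf : MemLp (fun ω => ∑ i : I, L (Pi.single i 1) * Z i ω) 2 P :=
    memLp_finsetSum _ fun i _ => (hZ i).const_mul _
  have hfH : hf.toLp _ ∈ H := by
    rw [toLp_finsetSum Finset.univ (fun i : I => L (Pi.single i 1)) (fun i : I => hZ i) hf]
    exact H.sum_mem fun i _ => H.smul_mem _ (hZH i)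
  have hm0 : ∫ ω, (∑ i : I, L (Pi.single i 1) * Z i ω) ∂P = 0 := by
    rw [integral_finsetSum _ fun (i : I) _ => ((hZ i).integrable (by norm_num)).const_mul _]
    refine Finset.sum_eq_zero fun i _ => ?_
    rw [integral_const_mul, h0, mul_zero]
  have hcomp : L ∘ (fun ω => I.restrict (Z · ω)) =
      fun ω => ∑ i : I, L (Pi.single i 1) * Z i ω := funext hL
  rw [hcomp, charFunDual_apply, integral_map hm (by fun_prop), hm0,
    variance_of_integral_eq_zero hf.aestronglyMeasurable.aemeasurable hm0]
  simp_rw [hL]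
  rw [hH.integral_exp hf hfH]
  push_cast
  congr 1
  simp

/-- The span of a centered Gaussian process is a Gaussian subspace. -/
lemma ProbabilityTheory.IsGaussianProcess.isGaussianSubspace_span {T : Type*} {Z : T → Ω → ℝ}
    (h : IsGaussianProcess Z P) (hZ : ∀ t, MemLp (Z t) 2 P) (h0 : ∀ t, ∫ ω, Z t ω ∂P = 0) :
    IsGaussianSubspace (Submodule.span ℝ (range fun t => (hZ t).toLp (Z t))) := by
  intro f hf
  obtain ⟨c, rfl⟩ := Finsupp.mem_span_range_iff_exists_finsupp.1 hf
  have hg : MemLp (fun ω => ∑ t ∈ c.support, c t * Z t ω) 2 P :=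
    memLp_finsetSum _ fun i _ => (hZ i).const_mul _
  have hsum : (c.sum fun t a => a • (hZ t).toLp (Z t)) = hg.toLp _ := by
    rw [toLp_finsetSum c.support c hZ hg]; rfl
  rw [hsum, norm_toLp_sq_eq_integral]
  have hlaw : HasGaussianLaw (fun ω => ∑ t ∈ c.support, c t * Z t ω) P := by
    let L : (c.support → ℝ) →L[ℝ] ℝ := ∑ t : c.support, c t • ContinuousLinearMap.proj t
    have hL : (fun ω => L (c.support.restrict (Z · ω))) =
        fun ω => ∑ t ∈ c.support, c t * Z t ω := by
      funext ω
      rw [← Finset.sum_coe_sort c.support (fun t => c t * Z t ω)]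
      simp [L]
    rw [← hL]
    exact (h.hasGaussianLaw c.support).map_fun L
  have hm0 : ∫ ω, (∑ t ∈ c.support, c t * Z t ω) ∂P = 0 := by
    have := h.isProbabilityMeasure
    rw [integral_finsetSum _ fun i _ => ((hZ i).integrable (by norm_num)).const_mul _]
    refine Finset.sum_eq_zero fun i _ => ?_
    rw [integral_const_mul, h0, mul_zero]
  have hch := hlaw.charFunDual_map_eq (ContinuousLinearMap.id ℝ ℝ)
  rw [charFunDual_apply, integral_map hlaw.aemeasurable (by fun_prop)] at hch
  simp only [ContinuousLinearMap.id_apply, ContinuousLinearMap.coe_id', Function.id_comp] at hch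
  have e : ∫ ω, Complex.exp ((hg.toLp _ : Lp ℝ 2 P) ω * Complex.I) ∂P =
      ∫ ω, Complex.exp (((∑ t ∈ c.support, c t * Z t ω : ℝ) : ℂ) * Complex.I) ∂P := by
    refine integral_congr_ae ?_
    filter_upwards [hg.coeFn_toLp] with ω hω
    rw [hω]
  rw [e, hch, hm0, variance_of_integral_eq_zero hlaw.aemeasurable hm0]
  push_cast
  congr 1
  simp

end GaussianSubspace

/-! ### Path integrals, and demeaning inside the closed span. -/

section Paths

set_option linter.unusedSectionVars false

variable {Ω : Type*} [MeasurableSpace Ω] {P : Measure Ω}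

/-- Lebesgue measure on the unit interval. -/
noncomputable abbrev unitVolume : Measure ℝ := volume.restrict (Icc (0 : ℝ) 1)

instance : IsProbabilityMeasure unitVolume := ⟨by simp⟩

lemma intervalIntegral_eq_unitVolume (f : ℝ → ℝ) :
    ∫ t in (0 : ℝ)..1, f t = ∫ t, f t ∂unitVolume := by
  rw [intervalIntegral.integral_of_le zero_le_one, ← integral_Icc_eq_integral_Ioc]

lemma ae_mem_unitVolume : ∀ᵐ t ∂unitVolume, t ∈ Icc (0 : ℝ) 1 :=
  ae_restrict_mem measurableSet_Icc

/-- The integral of a sample path against a weight. -/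
noncomputable def weightedIntegral (φ : ℝ → ℝ) (X : ℝ → Ω → ℝ) (ω : Ω) : ℝ :=
  ∫ t in (0 : ℝ)..1, φ t * X t ω

lemma sq_integral_le_integral_sq {f : ℝ → ℝ} (hf : MemLp f 2 unitVolume) :
    (∫ t, f t ∂unitVolume) ^ 2 ≤ ∫ t, f t ^ 2 ∂unitVolume := by
  have h := variance_nonneg f unitVolume
  rw [variance_eq_sub hf] at h
  simpa using h

namespace IsCenteredGaussianOnUnit

variable {X : ℝ → Ω → ℝ}

lemma memLp_eval (hX : IsCenteredGaussianOnUnit X P) {t : ℝ} (ht : t ∈ Icc (0 : ℝ) 1) :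
    MemLp (X t) 2 P :=
  (hX.gaussian.hasGaussianLaw_eval ⟨t, ht⟩).memLp_two

/-- The second moment at time `t` is the diagonal value of the covariance, which is continuous on
`[0,1]` and hence integrable; Tonelli then gives joint square integrability. -/
lemma memLp_uncurry [IsProbabilityMeasure P] (hX : IsCenteredGaussianOnUnit X P)
    (hc : ContinuousOn (Function.uncurry (covKernel X P)) (Icc 0 1 ×ˢ Icc 0 1)) :
    MemLp (Function.uncurry X) 2 (unitVolume.prod P) := by
  have hm := hX.aemeasurable.aestronglyMeasurable
  rw [memLp_two_iff_integrable_sq hm]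
  refine (integrable_prod_iff (hm.pow 2)).2 ?_
  constructor
  · filter_upwards [ae_mem_unitVolume] with t ht
    exact (hX.memLp_eval ht).integrable_sq
  · have hd : ContinuousOn (fun t => covKernel X P t t) (Icc 0 1) :=
      hc.comp (f := fun t => (t, t)) (by fun_prop) (fun t ht => ⟨ht, ht⟩)
    refine (hd.integrableOn_compact isCompact_Icc).congr ?_
    refine ae_of_all _ fun t => ?_
    simp [covKernel, pow_two]

variable [IsProbabilityMeasure P]

lemma memLp_mul_uncurry {φ : ℝ → ℝ} (hφ : Continuous φ)
    (h2 : MemLp (Function.uncurry X) 2 (unitVolume.prod P)) :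
    MemLp (fun p : ℝ × Ω => φ p.1 * X p.1 p.2) 2 (unitVolume.prod P) := by
  obtain ⟨M, hM⟩ := isCompact_Icc.exists_bound_of_continuousOn (hφ.continuousOn (s := Icc 0 1))
  refine MemLp.of_le_mul (c := M) h2 ?_ ?_
  · exact (hφ.measurable.comp measurable_fst).aestronglyMeasurable.mul h2.1
  · have h : ∀ᵐ p ∂(unitVolume.prod P), p.1 ∈ Icc (0 : ℝ) 1 :=
      Measure.quasiMeasurePreserving_fst.ae ae_mem_unitVolume
    filter_upwards [h] with p hp
    rw [norm_mul]
    exact mul_le_mul_of_nonneg_right (hM _ hp) (norm_nonneg _)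

lemma ae_memLp_path (h2 : MemLp (Function.uncurry X) 2 (unitVolume.prod P)) :
    ∀ᵐ ω ∂P, MemLp (fun t => X t ω) 2 unitVolume := by
  filter_upwards [(h2.integrable (by norm_num)).prod_left_ae, h2.integrable_sq.prod_left_ae]
    with ω h1 h3
  exact (memLp_two_iff_integrable_sq h1.aestronglyMeasurable).2 h3

lemma memLp_weightedIntegral {φ : ℝ → ℝ} (hφ : Continuous φ)
    (h2 : MemLp (Function.uncurry X) 2 (unitVolume.prod P)) :
    MemLp (weightedIntegral φ X) 2 P := by
  have hm := memLp_mul_uncurry hφ h2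
  have hae := ae_memLp_path (X := fun t ω => φ t * X t ω) hm
  have hm1 : AEStronglyMeasurable (weightedIntegral φ X) P := by
    have := (hm.integrable (by norm_num)).integral_prod_right.aestronglyMeasurable
    refine this.congr (ae_of_all _ fun ω => ?_)
    simp only [weightedIntegral, intervalIntegral_eq_unitVolume]
  rw [memLp_two_iff_integrable_sq hm1]
  refine hm.integrable_sq.integral_prod_right.mono' (hm1.pow 2) ?_
  filter_upwards [hae] with ω hω
  simp only [weightedIntegral, intervalIntegral_eq_unitVolume]
  rw [Real.norm_of_nonneg (sq_nonneg _)]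
  exact sq_integral_le_integral_sq hω

/-- Fubini for the product of a random variable and a path integral. -/
lemma integral_mul_weightedIntegral {φ : ℝ → ℝ} (hφ : Continuous φ)
    (h2 : MemLp (Function.uncurry X) 2 (unitVolume.prod P)) {V : Ω → ℝ} (hV : MemLp V 2 P) :
    ∫ ω, V ω * weightedIntegral φ X ω ∂P = ∫ s in (0 : ℝ)..1, φ s * ∫ ω, V ω * X s ω ∂P := by
  have hm := memLp_mul_uncurry hφ h2
  have hi : Integrable (fun p : ℝ × Ω => V p.2 * (φ p.1 * X p.1 p.2)) (unitVolume.prod P) :=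
    (hV.comp_snd unitVolume).integrable_mul hm
  simp only [weightedIntegral, intervalIntegral_eq_unitVolume]
  simp_rw [← integral_const_mul]
  rw [integral_integral_swap (f := fun s ω => φ s * (V ω * X s ω)) (hi.congr (ae_of_all _ fun p =>
    by simp only [Function.uncurry]; ring))]
  refine integral_congr_ae (ae_of_all _ fun ω => ?_)
  simp only
  refine integral_congr_ae (ae_of_all _ fun s => ?_)
  simp only
  ring

/-- The closed linear span of the values of the process. -/
noncomputable def span (hX : IsCenteredGaussianOnUnit X P) : Submodule ℝ (Lp ℝ 2 P) :=
  (Submodule.span ℝ (range fun t : Icc (0 : ℝ) 1 =>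
    (hX.memLp_eval t.2).toLp (X t))).topologicalClosure

lemma isGaussianSubspace_span (hX : IsCenteredGaussianOnUnit X P) :
    IsGaussianSubspace hX.span :=
  (hX.gaussian.isGaussianSubspace_span (fun t => hX.memLp_eval t.2)
    (fun t => hX.mean_zero t t.2)).topologicalClosure

lemma toLp_eval_mem_span (hX : IsCenteredGaussianOnUnit X P) {t : ℝ} (ht : t ∈ Icc (0 : ℝ) 1) :
    (hX.memLp_eval ht).toLp (X t) ∈ hX.span :=
  Submodule.le_topologicalClosure _ (Submodule.subset_span ⟨⟨t, ht⟩, rfl⟩)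

/-- The closed span is the double orthogonal complement. By Fubini, a variable orthogonal to every
`X s` is orthogonal to the path integral, so no Riemann sums or path continuity are needed. -/
lemma toLp_weightedIntegral_mem_span (hX : IsCenteredGaussianOnUnit X P) {φ : ℝ → ℝ}
    (hφ : Continuous φ) (h2 : MemLp (Function.uncurry X) 2 (unitVolume.prod P)) :
    (memLp_weightedIntegral hφ h2).toLp (weightedIntegral φ X) ∈ hX.span := by
  rw [span, ← Submodule.orthogonal_orthogonal_eq_closure, Submodule.mem_orthogonal]
  intro v hv
  rw [Submodule.mem_orthogonal] at hv
  have hvm := Lp.memLp v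
  have hve : v = hvm.toLp v := (Lp.toLp_coeFn v hvm).symm
  rw [hve, inner_toLp_eq_integral, integral_mul_weightedIntegral hφ h2 hvm]
  rw [intervalIntegral.integral_congr (g := fun _ => 0), intervalIntegral.integral_zero]
  intro s hs
  rw [uIcc_of_le zero_le_one] at hs
  have := hv _ (Submodule.subset_span ⟨⟨s, hs⟩, rfl⟩)
  rw [hve, inner_toLp_eq_integral] at this
  simp only
  rw [← mul_zero (φ s), ← this]
  congr 1
  exact integral_congr_ae (ae_of_all _ fun ω => mul_comm _ _)

lemma integral_weightedIntegral (hX : IsCenteredGaussianOnUnit X P) {φ : ℝ → ℝ}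
    (hφ : Continuous φ) (h2 : MemLp (Function.uncurry X) 2 (unitVolume.prod P)) :
    ∫ ω, weightedIntegral φ X ω ∂P = 0 := by
  have := integral_mul_weightedIntegral hφ h2 (V := fun _ => 1) (memLp_const 1)
  simp only [one_mul] at this
  rw [this, intervalIntegral.integral_congr (g := fun _ => 0), intervalIntegral.integral_zero]
  intro s hs
  rw [uIcc_of_le zero_le_one] at hs
  simp [hX.mean_zero s hs]

lemma integral_eval_mul_weightedIntegral (hX : IsCenteredGaussianOnUnit X P) {φ : ℝ → ℝ}
    (hφ : Continuous φ) (h2 : MemLp (Function.uncurry X) 2 (unitVolume.prod P))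
    {t : ℝ} (ht : t ∈ Icc (0 : ℝ) 1) :
    ∫ ω, X t ω * weightedIntegral φ X ω ∂P = ∫ s in (0 : ℝ)..1, φ s * covKernel X P t s :=
  integral_mul_weightedIntegral hφ h2 (hX.memLp_eval ht)

lemma integral_weightedIntegral_mul (hX : IsCenteredGaussianOnUnit X P) {φ ψ : ℝ → ℝ}
    (hφ : Continuous φ) (hψ : Continuous ψ)
    (h2 : MemLp (Function.uncurry X) 2 (unitVolume.prod P)) :
    ∫ ω, weightedIntegral φ X ω * weightedIntegral ψ X ω ∂P =
      ∫ t in (0 : ℝ)..1, ψ t * ∫ s in (0 : ℝ)..1, φ s * covKernel X P t s := by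
  rw [integral_mul_weightedIntegral hψ h2 (memLp_weightedIntegral hφ h2)]
  refine intervalIntegral.integral_congr fun t ht => ?_
  rw [uIcc_of_le zero_le_one] at ht
  rw [← hX.integral_eval_mul_weightedIntegral hφ h2 ht]
  congr 1
  exact integral_congr_ae (ae_of_all _ fun ω => mul_comm _ _)

end IsCenteredGaussianOnUnit

lemma demean_eq_sub_weightedIntegral (X : ℝ → Ω → ℝ) (t : ℝ) :
    demean X t = fun ω => X t ω - weightedIntegral (fun _ => 1) X ω := by
  funext ω
  simp [demean, weightedIntegral]

namespace IsCenteredGaussianOnUnit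

variable {X : ℝ → Ω → ℝ} [IsProbabilityMeasure P]

protected lemma demean (hX : IsCenteredGaussianOnUnit X P)
    (h2 : MemLp (Function.uncurry X) 2 (unitVolume.prod P)) :
    IsCenteredGaussianOnUnit (demean X) P := by
  have hm := memLp_weightedIntegral (φ := fun _ => 1) continuous_const h2
  have hmem := hX.toLp_weightedIntegral_mem_span (φ := fun _ => 1) continuous_const h2
  have h0 : ∀ t ∈ Icc (0 : ℝ) 1, ∫ ω, demean X t ω ∂P = 0 := by
    intro t ht
    rw [demean_eq_sub_weightedIntegral, integral_sub
      ((hX.memLp_eval ht).integrable (by norm_num)) (hm.integrable (by norm_num)),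
      hX.mean_zero t ht, hX.integral_weightedIntegral continuous_const h2, sub_zero]
  have hL : ∀ t ∈ Icc (0 : ℝ) 1, MemLp (demean X t) 2 P := by
    intro t ht
    rw [demean_eq_sub_weightedIntegral]
    exact (hX.memLp_eval ht).sub hm
  refine ⟨?_, h0, ?_⟩
  · refine hX.isGaussianSubspace_span.isGaussianProcess (fun t => hL t t.2) (fun t => ?_)
      (fun t => h0 t t.2)
    have : (hL t t.2).toLp (demean X t) = (hX.memLp_eval t.2).toLp (X t) - hm.toLp _ := by
      rw [← MemLp.toLp_sub]
      congr 1
      exact demean_eq_sub_weightedIntegral X t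
    rw [this]
    exact Submodule.sub_mem _ (hX.toLp_eval_mem_span t.2) hmem
  · have : Function.uncurry (demean X) = fun p : ℝ × Ω =>
        Function.uncurry X p - weightedIntegral (fun _ => 1) X p.2 := by
      funext p
      simp only [Function.uncurry, demean_eq_sub_weightedIntegral]
    rw [this]
    exact hX.aemeasurable.sub (hm.1.comp_snd).aemeasurable

/-- The terms `-c * (t + s) + c ^ 2` are sums of functions of one variable, so they cancel in the
doubly centered kernel. The value of `c` is therefore immaterial, and the twisted processes and the
Wiener process are treated together. -/
lemma covKernel_demean (hX : IsCenteredGaussianOnUnit X P)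
    (h2 : MemLp (Function.uncurry X) 2 (unitVolume.prod P)) {c : ℝ}
    (hK : ∀ t ∈ Icc (0 : ℝ) 1, ∀ s ∈ Icc (0 : ℝ) 1,
      covKernel X P t s = min t s - c * (t + s) + c ^ 2) :
    ∀ t ∈ Icc (0 : ℝ) 1, ∀ s ∈ Icc (0 : ℝ) 1, covKernel (demean X) P t s = neumannKernel t s := by
  have hm := memLp_weightedIntegral (φ := fun _ => 1) continuous_const h2
  have e1 : ∀ t ∈ Icc (0 : ℝ) 1, ∫ ω, X t ω * weightedIntegral (fun _ => 1) X ω ∂P =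
      t - t ^ 2 / 2 - c * t - c / 2 + c ^ 2 := by
    intro t ht
    rw [hX.integral_eval_mul_weightedIntegral continuous_const h2 ht]
    have : ∫ s in (0 : ℝ)..1, 1 * covKernel X P t s =
        ∫ s in (0 : ℝ)..1, (min t s - (c * t - c ^ 2 + c * s)) := by
      refine intervalIntegral.integral_congr fun s hs => ?_
      rw [uIcc_of_le zero_le_one] at hs
      simp only [hK t ht s hs]
      ring
    rw [this, intervalIntegral.integral_sub, integral_min ht, intervalIntegral.integral_add,
      intervalIntegral.integral_const_mul]
    · simp
      ring
    all_goals exact Continuous.intervalIntegrable (by fun_prop) _ _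
  have e2 : ∫ ω, weightedIntegral (fun _ => 1) X ω * weightedIntegral (fun _ => 1) X ω ∂P =
      1 / 3 - c + c ^ 2 := by
    rw [hX.integral_weightedIntegral_mul continuous_const continuous_const h2]
    have : ∫ t in (0 : ℝ)..1, 1 * ∫ s in (0 : ℝ)..1, 1 * covKernel X P t s =
        ∫ t in (0 : ℝ)..1, (t - t ^ 2 / 2 - c * t - c / 2 + c ^ 2) := by
      refine intervalIntegral.integral_congr fun t ht => ?_
      rw [uIcc_of_le zero_le_one] at ht
      rw [← hX.integral_eval_mul_weightedIntegral continuous_const h2 ht, e1 t ht, one_mul]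
    rw [this, intervalIntegral.integral_add, intervalIntegral.integral_sub,
      intervalIntegral.integral_sub, intervalIntegral.integral_sub,
      intervalIntegral.integral_const_mul]
    · simp
      ring
    all_goals exact Continuous.intervalIntegrable (by fun_prop) _ _
  intro t ht s hs
  have hXt := hX.memLp_eval ht
  have hXs := hX.memLp_eval hs
  have : ∀ ω, demean X t ω * demean X s ω = X t ω * X s ω -
      X t ω * weightedIntegral (fun _ => 1) X ω - X s ω * weightedIntegral (fun _ => 1) X ω +
      weightedIntegral (fun _ => 1) X ω * weightedIntegral (fun _ => 1) X ω := by
    intro ω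
    simp only [demean_eq_sub_weightedIntegral]
    ring
  have hK' := hK t ht s hs
  simp only [covKernel] at hK' ⊢
  simp_rw [this]
  have i1 : Integrable (fun ω => X t ω * X s ω) P :=
    hXt.integrable_mul hXs
  have i2 : Integrable (fun ω => X t ω * weightedIntegral (fun _ => 1) X ω) P :=
    hXt.integrable_mul hm
  have i3 : Integrable (fun ω => X s ω * weightedIntegral (fun _ => 1) X ω) P :=
    hXs.integrable_mul hm
  have i4 : Integrable (fun ω => weightedIntegral (fun _ => 1) X ω * weightedIntegral (fun _ => 1) X ω) P :=
    hm.integrable_mul hm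
  rw [integral_add (by exact (i1.sub i2).sub i3) i4, integral_sub (by exact i1.sub i2) i3,
    integral_sub i1 i2, e1 t ht, e1 s hs, e2, hK']
  unfold neumannKernel
  ring

end IsCenteredGaussianOnUnit

end Paths

/-! ### The Laplace transform of the squared norm. -/

section LaplaceTransform

set_option linter.unusedSectionVars false

/-- Euler's product for the hyperbolic sine. -/
lemma tendsto_euler_sinh_prod {x : ℝ} (hx : 0 < x) :
    Tendsto (fun n : ℕ => ∏ k ∈ Finset.range n, (1 + x ^ 2 / (Real.pi * (k + 1)) ^ 2)) atTop
      (𝓝 (Real.sinh x / x)) := by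
  -- At the imaginary point `z = i x / π` the factors `1 - z² / (j + 1)²` become `1 + x² / (π (j +
  -- 1))²`, and `sin (π z) = i sinh x`.
  have h := Complex.tendsto_euler_sin_prod (x / Real.pi * Complex.I)
  have hpi : (Real.pi : ℂ) ≠ 0 := by exact_mod_cast Real.pi_ne_zero
  have hxc : (x : ℂ) ≠ 0 := by exact_mod_cast hx.ne'
  have e1 : (Real.pi : ℂ) * (x / Real.pi * Complex.I) = x * Complex.I := by field_simp
  rw [e1, Complex.sin_mul_I] at h
  have h' := h.div_const (x * Complex.I)
  have e2 : Complex.sinh x * Complex.I / (x * Complex.I) = ((Real.sinh x / x : ℝ) : ℂ) := by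
    push_cast
    field_simp
  rw [e2] at h'
  have h3 := (Complex.continuous_re.tendsto _).comp h'
  rw [Complex.ofReal_re] at h3
  refine h3.congr fun n => ?_
  rw [Function.comp_apply, mul_div_cancel_left₀ _ (mul_ne_zero hxc Complex.I_ne_zero)]
  have : ∏ j ∈ Finset.range n, ((1 : ℂ) - (x / Real.pi * Complex.I) ^ 2 / ((j : ℂ) + 1) ^ 2) =
      ((∏ k ∈ Finset.range n, (1 + x ^ 2 / (Real.pi * (k + 1)) ^ 2) : ℝ) : ℂ) := by
    push_cast
    refine Finset.prod_congr rfl fun j _ => ?_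
    rw [mul_pow, Complex.I_sq]
    have : ((j : ℂ) + 1) ≠ 0 := by exact_mod_cast Nat.succ_ne_zero j
    field_simp
    ring
  rw [this, Complex.ofReal_re]

lemma integral_exp_neg_mul_sq_gaussianReal {s : ℝ} (hs : 0 ≤ s) (v : NNReal) :
    ∫ x, Real.exp (-s * x ^ 2) ∂(gaussianReal 0 v) = (√(1 + 2 * s * v))⁻¹ := by
  rcases eq_or_ne v 0 with rfl | hv
  · simp
  have hv' : (0 : ℝ) < v := by exact_mod_cast pos_iff_ne_zero.2 hv
  rw [integral_gaussianReal_eq_integral_smul hv]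
  have : ∀ x : ℝ, gaussianPDFReal 0 v x • Real.exp (-s * x ^ 2) =
      (√(2 * Real.pi * v))⁻¹ * Real.exp (-(1 / (2 * v) + s) * x ^ 2) := by
    intro x
    rw [gaussianPDFReal, smul_eq_mul, mul_assoc, ← Real.exp_add]
    congr 2
    field_simp
    ring
  simp_rw [this]
  rw [integral_const_mul, integral_gaussian, ← Real.sqrt_inv, ← Real.sqrt_inv,
    ← Real.sqrt_mul (by positivity)]
  congr 1
  have := Real.pi_pos
  field_simp

variable {Ω : Type*} [MeasurableSpace Ω] {P : Measure Ω}

/-- The squared `L²(0,1)` norm of a sample path. -/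
noncomputable def sqNorm (X : ℝ → Ω → ℝ) (ω : Ω) : ℝ := ∫ t in (0 : ℝ)..1, X t ω ^ 2

lemma sqNorm_nonneg (X : ℝ → Ω → ℝ) (ω : Ω) : 0 ≤ sqNorm X ω :=
  intervalIntegral.integral_nonneg zero_le_one fun _ _ => sq_nonneg _

lemma pathNorm_eq_sqrt_sqNorm (X : ℝ → Ω → ℝ) (ω : Ω) : pathNorm X ω = √(sqNorm X ω) := rfl

/-- Bessel's inequality for the system `cosBasis`. -/
lemma sum_sq_integral_cosBasis_le {f : ℝ → ℝ} (hf : MemLp f 2 unitVolume) (n : ℕ) :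
    ∑ k ∈ Finset.range n, (∫ t in (0 : ℝ)..1, cosBasis k t * f t) ^ 2 ≤
      ∫ t in (0 : ℝ)..1, f t ^ 2 := by
  simp only [intervalIntegral_eq_unitVolume]
  have hc : ∀ k, MemLp (cosBasis k) 2 unitVolume := fun k => by
    refine MemLp.of_bound (continuous_cosBasis k).aestronglyMeasurable (√2) (ae_of_all _ fun t => ?_)
    rw [cosBasis, norm_mul, Real.norm_of_nonneg (Real.sqrt_nonneg 2)]
    exact mul_le_of_le_one_right (Real.sqrt_nonneg 2) (Real.abs_cos_le_one _)
  have ho : Orthonormal ℝ (fun k => (hc k).toLp (cosBasis k)) := by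
    rw [orthonormal_iff_ite]
    intro i j
    rw [inner_toLp_eq_integral, ← intervalIntegral_eq_unitVolume, integral_cosBasis_mul]
  have h := ho.sum_inner_products_le (hf.toLp f) (s := Finset.range n)
  rw [norm_toLp_sq_eq_integral] at h
  simpa only [inner_toLp_eq_integral, Real.norm_eq_abs, sq_abs] using h

namespace IsCenteredGaussianOnUnit

variable {Y : ℝ → Ω → ℝ} [IsProbabilityMeasure P]

lemma memLp_uncurry_of_neumannKernel (hY : IsCenteredGaussianOnUnit Y P)
    (hK : ∀ t ∈ Icc (0 : ℝ) 1, ∀ s ∈ Icc (0 : ℝ) 1, covKernel Y P t s = neumannKernel t s) :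
    MemLp (Function.uncurry Y) 2 (unitVolume.prod P) :=
  hY.memLp_uncurry (continuous_neumannKernel.continuousOn.congr
    fun p hp => hK p.1 hp.1 p.2 hp.2)

lemma integrable_sqNorm (h2 : MemLp (Function.uncurry Y) 2 (unitVolume.prod P)) :
    Integrable (sqNorm Y) P := by
  refine h2.integrable_sq.integral_prod_right.congr (ae_of_all _ fun ω => ?_)
  simp only [sqNorm, intervalIntegral_eq_unitVolume, Function.uncurry]

/-- The expected squared norm is the trace of the kernel. Its equality with the sum of the variances
of the cosine coefficients is what stands in for completeness of the cosines. -/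
lemma integral_sqNorm (hY : IsCenteredGaussianOnUnit Y P)
    (hK : ∀ t ∈ Icc (0 : ℝ) 1, ∀ s ∈ Icc (0 : ℝ) 1, covKernel Y P t s = neumannKernel t s) :
    ∫ ω, sqNorm Y ω ∂P = 1 / 6 := by
  have h2 := hY.memLp_uncurry_of_neumannKernel hK
  rw [← integral_neumannKernel_diag]
  simp only [sqNorm, intervalIntegral_eq_unitVolume]
  rw [← integral_integral_swap (f := fun t ω => Y t ω ^ 2) h2.integrable_sq]
  refine integral_congr_ae ?_
  filter_upwards [ae_mem_unitVolume] with t ht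
  rw [← hK t ht t ht, covKernel]
  simp_rw [pow_two]

lemma integral_cosCoeff_mul (hY : IsCenteredGaussianOnUnit Y P)
    (hK : ∀ t ∈ Icc (0 : ℝ) 1, ∀ s ∈ Icc (0 : ℝ) 1, covKernel Y P t s = neumannKernel t s)
    (j k : ℕ) :
    ∫ ω, weightedIntegral (cosBasis j) Y ω * weightedIntegral (cosBasis k) Y ω ∂P =
      if j = k then 1 / (Real.pi * (k + 1)) ^ 2 else 0 := by
  have h2 := hY.memLp_uncurry_of_neumannKernel hK
  rw [hY.integral_weightedIntegral_mul (continuous_cosBasis j) (continuous_cosBasis k) h2]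
  have : ∀ t ∈ Icc (0 : ℝ) 1, cosBasis k t * ∫ s in (0 : ℝ)..1, cosBasis j s * covKernel Y P t s =
      (1 / (Real.pi * (j + 1)) ^ 2) * (cosBasis j t * cosBasis k t) := by
    intro t ht
    have e : ∫ s in (0 : ℝ)..1, cosBasis j s * covKernel Y P t s =
        ∫ s in (0 : ℝ)..1, cosBasis j s * neumannKernel t s := by
      refine intervalIntegral.integral_congr fun s hs => ?_
      rw [uIcc_of_le zero_le_one] at hs
      simp only [hK t ht s hs]
    rw [e, integral_neumannKernel_mul_cosBasis j ht]
    ring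
  rw [intervalIntegral.integral_congr (fun t ht => this t (by rwa [uIcc_of_le zero_le_one] at ht)),
    intervalIntegral.integral_const_mul, integral_cosBasis_mul]
  split_ifs with h
  · rw [h, mul_one]
  · rw [mul_zero]

lemma isGaussianProcess_cosCoeff (hY : IsCenteredGaussianOnUnit Y P)
    (h2 : MemLp (Function.uncurry Y) 2 (unitVolume.prod P)) :
    IsGaussianProcess (fun k => weightedIntegral (cosBasis k) Y) P :=
  hY.isGaussianSubspace_span.isGaussianProcess
    (fun k => memLp_weightedIntegral (continuous_cosBasis k) h2)
    (fun k => hY.toLp_weightedIntegral_mem_span (continuous_cosBasis k) h2)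
    (fun k => hY.integral_weightedIntegral (continuous_cosBasis k) h2)

/-- The coefficients are jointly Gaussian and uncorrelated, hence independent. The expectation
factors into one-dimensional integrals `(1 + 2 s σ²)^(-1/2)`, where `σ²` is the variance. -/
lemma integral_exp_neg_sum_sq_cosCoeff (hY : IsCenteredGaussianOnUnit Y P)
    (hK : ∀ t ∈ Icc (0 : ℝ) 1, ∀ s ∈ Icc (0 : ℝ) 1, covKernel Y P t s = neumannKernel t s)
    {s : ℝ} (hs : 0 ≤ s) (n : ℕ) :
    ∫ ω, Real.exp (-s * ∑ k ∈ Finset.range n, weightedIntegral (cosBasis k) Y ω ^ 2) ∂P =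
      (√(∏ k ∈ Finset.range n, (1 + 2 * s / (Real.pi * (k + 1)) ^ 2)))⁻¹ := by
  have h2 := hY.memLp_uncurry_of_neumannKernel hK
  have hg := hY.isGaussianProcess_cosCoeff h2
  have h0 : ∀ k, ∫ ω, weightedIntegral (cosBasis k) Y ω ∂P = 0 :=
    fun k => hY.integral_weightedIntegral (continuous_cosBasis k) h2
  have hL : ∀ k, MemLp (weightedIntegral (cosBasis k) Y) 2 P :=
    fun k => memLp_weightedIntegral (continuous_cosBasis k) h2
  have hind : iIndepFun (fun k : Finset.range n => weightedIntegral (cosBasis k) Y) P := by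
    refine (hg.hasGaussianLaw (Finset.range n)).iIndepFun_of_covariance_eq_zero fun i j hij => ?_
    change cov[weightedIntegral (cosBasis i) Y, weightedIntegral (cosBasis j) Y; P] = 0
    rw [covariance_eq_sub (hL i) (hL j), h0, zero_mul, sub_zero]
    have := hY.integral_cosCoeff_mul hK i j
    rw [if_neg (fun h => hij (Subtype.ext h))] at this
    exact this
  have hone : ∀ k, ∫ ω, Real.exp (-s * weightedIntegral (cosBasis k) Y ω ^ 2) ∂P =
      (√(1 + 2 * s / (Real.pi * (k + 1)) ^ 2))⁻¹ := by
    intro k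
    have hlaw := (hg.hasGaussianLaw_eval k).map_eq_gaussianReal
    rw [h0, variance_of_integral_eq_zero (hL k).aestronglyMeasurable.aemeasurable (h0 k)] at hlaw
    have hvar : ∫ ω, weightedIntegral (cosBasis k) Y ω ^ 2 ∂P = 1 / (Real.pi * (k + 1)) ^ 2 := by
      have := hY.integral_cosCoeff_mul hK k k
      rw [if_pos rfl] at this
      rw [← this]
      simp_rw [pow_two]
    rw [hvar] at hlaw
    have := integral_exp_neg_mul_sq_gaussianReal hs (1 / (Real.pi * ((k : ℝ) + 1)) ^ 2).toNNReal
    rw [← hlaw, integral_map (hL k).aestronglyMeasurable.aemeasurable (by fun_prop),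
      Real.coe_toNNReal _ (by positivity)] at this
    rw [this]
    congr 3
    ring
  have hprod := hind.integral_fun_prod_comp
    (f := fun _ x => Real.exp (-s * x ^ 2)) (fun k => (hL k).aestronglyMeasurable.aemeasurable)
    (fun k => by fun_prop)
  have e1 : ∀ ω, Real.exp (-s * ∑ k ∈ Finset.range n, weightedIntegral (cosBasis k) Y ω ^ 2) =
      ∏ k : Finset.range n, Real.exp (-s * weightedIntegral (cosBasis k) Y ω ^ 2) := by
    intro ω
    rw [Finset.mul_sum, Real.exp_sum, ← Finset.prod_coe_sort]
  simp_rw [e1]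
  rw [hprod, Finset.prod_coe_sort (Finset.range n)
    (fun k => ∫ ω, Real.exp (-s * weightedIntegral (cosBasis k) Y ω ^ 2) ∂P)]
  simp_rw [hone]
  rw [Finset.prod_inv_distrib]
  congr 1
  rw [Real.sqrt_prod]
  intro k _
  positivity

/-- The Laplace transform of the squared norm of the demeaned Wiener process. -/
lemma integral_exp_neg_mul_sqNorm (hY : IsCenteredGaussianOnUnit Y P)
    (hK : ∀ t ∈ Icc (0 : ℝ) 1, ∀ s ∈ Icc (0 : ℝ) 1, covKernel Y P t s = neumannKernel t s)
    {θ : ℝ} (hθ : 0 < θ) :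
    ∫ ω, Real.exp (-(θ ^ 2 / 2) * sqNorm Y ω) ∂P = √(θ / Real.sinh θ) := by
  have h2 := hY.memLp_uncurry_of_neumannKernel hK
  have hL : ∀ k, MemLp (weightedIntegral (cosBasis k) Y) 2 P :=
    fun k => memLp_weightedIntegral (continuous_cosBasis k) h2
  set s := θ ^ 2 / 2 with hs
  have hs0 : 0 ≤ s := by positivity
  set S : ℕ → Ω → ℝ := fun n ω => ∑ k ∈ Finset.range n, weightedIntegral (cosBasis k) Y ω ^ 2
  have hSi : ∀ n, Integrable (S n) P := fun n => integrable_finsetSum _ fun k _ => (hL k).integrable_sq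
  have hQi := integrable_sqNorm h2
  have hexp : ∀ f : Ω → ℝ, Integrable f P → (∀ ω, 0 ≤ f ω) →
      Integrable (fun ω => Real.exp (-s * f ω)) P := by
    intro f hf hf0
    refine Integrable.of_bound (C := 1) (Real.continuous_exp.comp_aestronglyMeasurable
      (hf.aestronglyMeasurable.const_mul _)) (ae_of_all _ fun ω => ?_)
    rw [Real.norm_of_nonneg (Real.exp_nonneg _), Real.exp_le_one_iff]
    nlinarith [hf0 ω]
  have hS0 : ∀ n ω, 0 ≤ S n ω := fun n ω => Finset.sum_nonneg fun k _ => sq_nonneg _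
  have hbessel : ∀ n, ∀ᵐ ω ∂P, S n ω ≤ sqNorm Y ω := by
    intro n
    filter_upwards [ae_memLp_path h2] with ω hω
    exact sum_sq_integral_cosBasis_le hω n
  have hlim1 : Tendsto (fun n => ∫ ω, Real.exp (-s * S n ω) ∂P) atTop
      (𝓝 (∫ ω, Real.exp (-s * sqNorm Y ω) ∂P)) := by
    have hES : ∀ n, ∫ ω, S n ω ∂P = ∑ k ∈ Finset.range n, 1 / (Real.pi * ((k : ℝ) + 1)) ^ 2 := by
      intro n
      simp only [S]
      rw [integral_finsetSum _ fun k _ => (hL k).integrable_sq]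
      refine Finset.sum_congr rfl fun k _ => ?_
      have := hY.integral_cosCoeff_mul hK k k
      rw [if_pos rfl] at this
      rw [← this]
      simp_rw [pow_two]
    have hbasel : Tendsto (fun n => ∑ k ∈ Finset.range n, 1 / (Real.pi * ((k : ℝ) + 1)) ^ 2) atTop
        (𝓝 (1 / 6)) := by
      -- The series of `1 / n ^ 2` includes `n = 0`, where the term is `0` by convention; removing
      -- it shifts the index to `k + 1`.
      have h := hasSum_zeta_two
      rw [← hasSum_nat_add_iff' 1] at h
      have h' := (h.mul_left (1 / Real.pi ^ 2)).tendsto_sum_nat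
      convert h' using 2
      · refine Finset.sum_congr rfl fun k _ => ?_
        push_cast
        rw [mul_pow, one_div_mul_one_div]
      · have := Real.pi_pos
        simp
        field_simp
    have hdiff : Tendsto (fun n => s * (1 / 6 - ∑ k ∈ Finset.range n,
        1 / (Real.pi * ((k : ℝ) + 1)) ^ 2)) atTop (𝓝 0) := by
      have := (hbasel.const_sub (1 / 6)).const_mul s
      simpa using this
    rw [tendsto_iff_norm_sub_tendsto_zero]
    refine squeeze_zero (fun _ => norm_nonneg _) (fun n => ?_) hdiff
    rw [← integral_sub (hexp _ (hSi n) (hS0 n)) (hexp _ hQi (sqNorm_nonneg Y)), ← hES n,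
      ← hY.integral_sqNorm hK, ← integral_sub hQi (hSi n), ← integral_const_mul]
    refine (norm_integral_le_integral_norm _).trans (integral_mono_ae ?_ ?_ ?_)
    · exact ((hexp _ (hSi n) (hS0 n)).sub (hexp _ hQi (sqNorm_nonneg Y))).norm
    · exact (hQi.sub (hSi n)).const_mul s
    · filter_upwards [hbessel n] with ω hω
      have h1 : -s * sqNorm Y ω ≤ -s * S n ω := by nlinarith
      rw [Real.norm_of_nonneg (sub_nonneg.2 (Real.exp_le_exp.2 h1))]
      -- With `exp (-x) ≥ 1 - x`, the difference of exponentials is at most `s * (sqNorm Y ω - S n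
      -- ω)`, whose expectation tends to zero.
      have e : Real.exp (-s * sqNorm Y ω) =
          Real.exp (-s * S n ω) * Real.exp (-(s * (sqNorm Y ω - S n ω))) := by
        rw [← Real.exp_add]; congr 1; ring
      have h3 : Real.exp (-s * S n ω) ≤ 1 := Real.exp_le_one_iff.2 (by nlinarith [hS0 n ω])
      have h4 := Real.add_one_le_exp (-(s * (sqNorm Y ω - S n ω)))
      have h5 : 0 ≤ s * (sqNorm Y ω - S n ω) := mul_nonneg hs0 (by linarith)
      have h6 := Real.exp_pos (-s * S n ω)
      rw [e]
      nlinarith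
  have hlim2 : Tendsto (fun n => ∫ ω, Real.exp (-s * S n ω) ∂P) atTop
      (𝓝 (√(Real.sinh θ / θ))⁻¹) := by
    have hpos : 0 < Real.sinh θ / θ := div_pos (Real.sinh_pos_iff.2 hθ) hθ
    have h := ((tendsto_euler_sinh_prod hθ).sqrt).inv₀ (Real.sqrt_pos.2 hpos).ne'
    refine h.congr fun n => ?_
    rw [hY.integral_exp_neg_sum_sq_cosCoeff hK hs0 n]
    have : 2 * s = θ ^ 2 := by rw [hs]; ring
    rw [this]
  rw [tendsto_nhds_unique hlim1 hlim2, ← Real.sqrt_inv, inv_div]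

end IsCenteredGaussianOnUnit

end LaplaceTransform

/-! ### Uniqueness of Laplace transforms on the half-line. -/

section LaplaceUniqueness

-- Polynomials in `exp (-x)` form a point-separating algebra of bounded continuous functions, which
-- determines a finite measure. Their integrals are linear combinations of the values in the
-- hypothesis, with `n = 0` accounting for the constant term.
open BoundedContinuousFunction in
lemma measure_nnreal_ext_of_integral_exp {μ ν : Measure NNReal} [IsFiniteMeasure μ]
    [IsFiniteMeasure ν]
    (h : ∀ n : ℕ, ∫ x, Real.exp (-(n * (x : ℝ))) ∂μ = ∫ x, Real.exp (-(n * (x : ℝ))) ∂ν) :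
    μ = ν := by
  let g : BoundedContinuousFunction NNReal ℝ :=
    BoundedContinuousFunction.ofNormedAddCommGroup (fun x : NNReal => Real.exp (-(x : ℝ)))
      (by fun_prop) 1 (fun x => by
        rw [Real.norm_of_nonneg (Real.exp_nonneg _), Real.exp_le_one_iff]
        simp)
  have hg : ∀ x, g x = Real.exp (-(x : ℝ)) := fun _ => rfl
  let A : StarSubalgebra ℝ (BoundedContinuousFunction NNReal ℝ) :=
    { Algebra.adjoin ℝ {g} with
      star_mem' := fun {f} hf => by
        have : star f = f := by ext x; simp
        rwa [this] }
  have hA : ∀ f, f ∈ A ↔ f ∈ Algebra.adjoin ℝ {g} := fun _ => Iff.rfl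
  refine ext_of_forall_mem_subalgebra_integral_eq_of_polish (𝕜 := ℝ) (A := A) ?_ ?_
  · intro x y hxy
    refine ⟨g, ⟨toContinuousMapStarₐ ℝ g, ⟨g, (hA g).2 (Algebra.subset_adjoin rfl), rfl⟩, rfl⟩, ?_⟩
    rw [hg, hg]
    intro he
    have := Real.exp_injective he
    exact hxy (NNReal.coe_injective (neg_injective this))
  · intro f hf
    rw [hA, Algebra.adjoin_singleton_eq_range_aeval] at hf
    obtain ⟨p, rfl⟩ := hf
    have e : ∀ x, (Polynomial.aeval g p : BoundedContinuousFunction NNReal ℝ) x =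
        ∑ i ∈ Finset.range (p.natDegree + 1), p.coeff i * Real.exp (-(i * (x : ℝ))) := by
      intro x
      rw [Polynomial.aeval_eq_sum_range]
      simp only [BoundedContinuousFunction.sum_apply, BoundedContinuousFunction.smul_apply,
        BoundedContinuousFunction.pow_apply, hg, smul_eq_mul, ← Real.exp_nat_mul, mul_neg]
    have hi : ∀ (ρ : Measure NNReal) [IsFiniteMeasure ρ] (i : ℕ),
        Integrable (fun x : NNReal => Real.exp (-(i * (x : ℝ)))) ρ := by
      intro ρ _ i
      refine Integrable.of_bound (C := 1) (by fun_prop) (ae_of_all _ fun x => ?_)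
      rw [Real.norm_of_nonneg (Real.exp_nonneg _), Real.exp_le_one_iff]
      simp only [Left.neg_nonpos_iff]
      positivity
    simp only [AlgHom.toRingHom_eq_coe, RingHom.coe_coe, e]
    rw [integral_finsetSum _ fun i _ => (hi μ i).const_mul _,
      integral_finsetSum _ fun i _ => (hi ν i).const_mul _]
    refine Finset.sum_congr rfl fun i _ => ?_
    rw [integral_const_mul, integral_const_mul, h i]

/-- A finite measure on `[0, ∞)` is determined by its Laplace transform at the integers. -/
lemma measure_ext_of_lintegral_exp {μ ν : Measure ℝ} [IsFiniteMeasure μ] [IsFiniteMeasure ν]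
    (hμ : ∀ᵐ x ∂μ, 0 ≤ x) (hν : ∀ᵐ x ∂ν, 0 ≤ x)
    (h : ∀ n : ℕ, ∫⁻ x, ENNReal.ofReal (Real.exp (-(n * x))) ∂μ =
      ∫⁻ x, ENNReal.ofReal (Real.exp (-(n * x))) ∂ν) : μ = ν := by
  have hback : ∀ ρ : Measure ℝ, (∀ᵐ x ∂ρ, 0 ≤ x) →
      (ρ.map Real.toNNReal).map ((↑) : NNReal → ℝ) = ρ := by
    intro ρ hρ
    rw [Measure.map_map (by fun_prop) (by fun_prop)]
    conv_rhs => rw [← Measure.map_id (μ := ρ)]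
    refine Measure.map_congr ?_
    filter_upwards [hρ] with x hx
    simp [hx]
  have hint : ∀ ρ : Measure ℝ, (∀ᵐ x ∂ρ, 0 ≤ x) → ∀ n : ℕ,
      ∫ x : NNReal, Real.exp (-(n * (x : ℝ))) ∂(ρ.map Real.toNNReal) =
        (∫⁻ x, ENNReal.ofReal (Real.exp (-(n * x))) ∂ρ).toReal := by
    intro ρ hρ n
    rw [integral_map (by fun_prop) (by fun_prop),
      integral_eq_lintegral_of_nonneg_ae (ae_of_all _ fun x => Real.exp_nonneg _) (by fun_prop)]
    congr 1
    refine lintegral_congr_ae ?_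
    filter_upwards [hρ] with x hx
    simp [hx]
  rw [← hback μ hμ, ← hback ν hν]
  congr 1
  refine measure_nnreal_ext_of_integral_exp fun n => ?_
  rw [hint μ hμ, hint ν hν, h]

end LaplaceUniqueness

/-! ### The binomial series and explicit Laplace integrals. -/

section InverseLaplace

/-- The binomial series of `(1 - q)^(-1/2)` has nonnegative coefficients. -/
lemma exists_inv_sqrt_one_sub_series :
    ∃ c : ℕ → ℝ, c 0 = 1 ∧ (∀ k, 0 ≤ c k) ∧
      ∀ q : ℝ, 0 ≤ q → q < 1 → HasSum (fun k => c k * q ^ k) (√(1 - q))⁻¹ := by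
  refine ⟨fun n => Ring.choose ((1 / 2 : ℝ) + n - 1) n, by simp, fun k => ?_, fun q h0 h1 => ?_⟩
  -- Multiplied by `k!`, the coefficient is the rising factorial of `1/2`, a product of positive
  -- factors.
  · have h := Ring.descPochhammer_eq_factorial_smul_choose ((1 / 2 : ℝ) + k - 1) k
    have h2 : 0 ≤ (k.factorial : ℝ) * Ring.choose ((1 / 2 : ℝ) + k - 1) k := by
      rw [← nsmul_eq_mul, ← h, Polynomial.descPochhammer_smeval_eq_ascPochhammer,
        Polynomial.ascPochhammer_smeval_eq_eval]
      exact (ascPochhammer_pos k _ (by linarith)).le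
    exact nonneg_of_mul_nonneg_right h2 (by positivity)
  · have h := (Real.one_div_one_sub_rpow_hasFPowerSeriesOnBall_zero (1 / 2)).hasSum (y := q)
      (by simp [enorm_eq_nnnorm, ← NNReal.coe_lt_coe, abs_of_nonneg h0, h1])
    simp only [FormalMultilinearSeries.ofScalars_apply_eq, zero_add, smul_eq_mul] at h
    rw [Real.sqrt_eq_rpow, ← one_div]
    exact h

lemma lintegral_rpow_mul_exp_neg_mul {a r : ℝ} (ha : 0 < a) (hr : 0 < r) :
    ∫⁻ z in Ioi (0 : ℝ), ENNReal.ofReal (z ^ (a - 1) * Real.exp (-(r * z))) =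
      ENNReal.ofReal ((1 / r) ^ a * Real.Gamma a) := by
  rw [← Real.integral_rpow_mul_exp_neg_mul_Ioi ha hr, ofReal_integral_eq_lintegral_ofReal]
  · have := integrableOn_rpow_mul_exp_neg_mul_rpow (p := 1) (s := a - 1) (b := r)
      (by linarith) one_pos hr
    simpa [IntegrableOn, neg_mul] using this
  · filter_upwards [ae_restrict_mem measurableSet_Ioi] with z hz
    have : 0 < z := hz
    positivity

/-- The primitive of the Gaussian weight, vanishing at zero. -/
noncomputable def gaussPrimitive (x : ℝ) : ℝ := ∫ u in (0 : ℝ)..x, Real.exp (-(1 / 2) * u ^ 2)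

lemma hasDerivAt_gaussPrimitive (x : ℝ) :
    HasDerivAt gaussPrimitive (Real.exp (-(1 / 2) * x ^ 2)) x :=
  (Continuous.integral_hasStrictDerivAt (by fun_prop) 0 x).hasDerivAt

lemma gaussPrimitive_neg (x : ℝ) : gaussPrimitive (-x) = -gaussPrimitive x := by
  unfold gaussPrimitive
  have := intervalIntegral.integral_comp_neg (a := 0) (b := x)
    (fun u => Real.exp (-(1 / 2) * u ^ 2))
  simp only [neg_sq, neg_zero] at this
  rw [this, intervalIntegral.integral_symm]

lemma tendsto_gaussPrimitive_atTop :
    Tendsto gaussPrimitive atTop (𝓝 (√(2 * Real.pi) / 2)) := by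
  have h := intervalIntegral_tendsto_integral_Ioi (0 : ℝ)
    (integrable_exp_neg_mul_sq (b := 1 / 2) (by norm_num)).integrableOn tendsto_id
  rw [integral_gaussian_Ioi] at h
  rwa [show Real.pi / (1 / 2) = 2 * Real.pi by ring] at h

lemma tendsto_gaussPrimitive_atBot :
    Tendsto gaussPrimitive atBot (𝓝 (-(√(2 * Real.pi) / 2))) := by
  have := (tendsto_gaussPrimitive_atTop.comp tendsto_neg_atBot_atTop).neg
  refine this.congr fun x => ?_
  simp [gaussPrimitive_neg]

/-- The Laplace transform of `t ↦ t^(-1/2) exp(-b²/(2t))`. -/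
lemma lintegral_inv_sqrt_mul_exp {b θ : ℝ} (hb : 0 < b) (hθ : 0 < θ) :
    ∫⁻ t in Ioi (0 : ℝ), ENNReal.ofReal ((√t)⁻¹ * Real.exp (-(b ^ 2 / (2 * t)) - θ ^ 2 / 2 * t)) =
      ENNReal.ofReal (√(2 * Real.pi) / θ * Real.exp (-(b * θ))) := by
  -- An antiderivative: the arguments `θ√t ∓ b/√t` complete the square, leaving factors `exp (± b
  -- θ)` that the coefficients compensate, and the `t^(-3/2)` parts of the two inner derivatives
  -- cancel. Only the first argument has limits of opposite sign at `0` and `∞`, so it alone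
  -- contributes to `l₁ - l₀`.
  let g : ℝ → ℝ := fun t => θ⁻¹ * (Real.exp (-(b * θ)) * gaussPrimitive (θ * √t - b / √t) +
    Real.exp (b * θ) * gaussPrimitive (θ * √t + b / √t))
  set C := √(2 * Real.pi) / 2 with hC
  let l₀ : ℝ := θ⁻¹ * (Real.exp (-(b * θ)) * (-C) + Real.exp (b * θ) * C)
  let l₁ : ℝ := θ⁻¹ * (Real.exp (-(b * θ)) * C + Real.exp (b * θ) * C)
  have hsq0 : Tendsto (fun t : ℝ => √t) (𝓝[>] 0) (𝓝[>] 0) := by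
    refine tendsto_nhdsWithin_iff.2 ⟨?_, ?_⟩
    · have := Real.continuous_sqrt.tendsto 0
      rw [Real.sqrt_zero] at this
      exact this.mono_left nhdsWithin_le_nhds
    · filter_upwards [self_mem_nhdsWithin] with t ht
      exact Real.sqrt_pos.2 ht
  have hθ0 : Tendsto (fun t : ℝ => θ * √t) (𝓝[>] 0) (𝓝 0) := by
    have := (hsq0.mono_right nhdsWithin_le_nhds).const_mul θ
    simpa using this
  have hb0 : Tendsto (fun t : ℝ => b / √t) (𝓝[>] 0) atTop :=
    (tendsto_inv_nhdsGT_zero.comp hsq0).const_mul_atTop hb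
  have hθ1 : Tendsto (fun t : ℝ => θ * √t) atTop atTop :=
    Real.tendsto_sqrt_atTop.const_mul_atTop hθ
  have hb1 : Tendsto (fun t : ℝ => b / √t) atTop (𝓝 0) :=
    Real.tendsto_sqrt_atTop.const_div_atTop b
  have hlim0 : Tendsto g (𝓝[>] 0) (𝓝 l₀) := by
    refine Tendsto.const_mul _ (Tendsto.add (Tendsto.const_mul _ ?_) (Tendsto.const_mul _ ?_))
    · refine tendsto_gaussPrimitive_atBot.comp ?_
      simp_rw [sub_eq_add_neg]
      exact hθ0.add_atBot (tendsto_neg_atTop_atBot.comp hb0)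
    · exact tendsto_gaussPrimitive_atTop.comp (hθ0.add_atTop hb0)
  have hlim1 : Tendsto g atTop (𝓝 l₁) := by
    refine Tendsto.const_mul _ (Tendsto.add (Tendsto.const_mul _ ?_) (Tendsto.const_mul _ ?_))
    · refine tendsto_gaussPrimitive_atTop.comp ?_
      simp_rw [sub_eq_add_neg]
      exact hθ1.atTop_add hb1.neg
    · exact tendsto_gaussPrimitive_atTop.comp (hθ1.atTop_add hb1)
  have hderiv : ∀ t ∈ Ioi (0 : ℝ), HasDerivAt g
      ((√t)⁻¹ * Real.exp (-(b ^ 2 / (2 * t)) - θ ^ 2 / 2 * t)) t := by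
    intro t ht
    have ht' : 0 < t := ht
    have hst : 0 < √t := Real.sqrt_pos.2 ht
    have hsq : √t ^ 2 = t := Real.sq_sqrt ht'.le
    have h1 : HasDerivAt (fun t : ℝ => √t) (1 / (2 * √t)) t := Real.hasDerivAt_sqrt ht'.ne'
    have h2 : HasDerivAt (fun t : ℝ => b / √t) (-(b * (1 / (2 * √t))) / √t ^ 2) t := by
      refine ((hasDerivAt_const t b).div h1 hst.ne').congr_deriv ?_
      rw [zero_mul, zero_sub]
    have h3 := (hasDerivAt_gaussPrimitive (θ * √t - b / √t)).comp t ((h1.const_mul θ).sub h2)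
    have h4 := (hasDerivAt_gaussPrimitive (θ * √t + b / √t)).comp t ((h1.const_mul θ).add h2)
    refine (((h3.const_mul (Real.exp (-(b * θ)))).add
      (h4.const_mul (Real.exp (b * θ)))).const_mul θ⁻¹).congr_deriv ?_
    have hexp : -(b ^ 2 / (2 * t)) - θ ^ 2 / 2 * t =
        -(b ^ 2 / (2 * √t ^ 2)) - θ ^ 2 / 2 * √t ^ 2 := by rw [hsq]
    have e1 : Real.exp (-(b * θ)) * Real.exp (-(1 / 2) * (θ * √t - b / √t) ^ 2) =
        Real.exp (-(b ^ 2 / (2 * t)) - θ ^ 2 / 2 * t) := by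
      rw [← Real.exp_add]
      congr 1
      rw [hexp]
      field_simp
      ring
    have e2 : Real.exp (b * θ) * Real.exp (-(1 / 2) * (θ * √t + b / √t) ^ 2) =
        Real.exp (-(b ^ 2 / (2 * t)) - θ ^ 2 / 2 * t) := by
      rw [← Real.exp_add]
      congr 1
      rw [hexp]
      field_simp
      ring
    rw [← mul_assoc, ← mul_assoc, e1, e2]
    field_simp
    ring
  have hpos : ∀ t ∈ Ioi (0 : ℝ), 0 ≤ (√t)⁻¹ * Real.exp (-(b ^ 2 / (2 * t)) - θ ^ 2 / 2 * t) :=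
    fun t _ => by positivity
  -- Since `b / √0 = 0` by convention, `g 0` is not the right limit `l₀`; the value at `0` is
  -- corrected to obtain continuity there.
  let G : ℝ → ℝ := Function.update g 0 l₀
  have hGcont : ContinuousWithinAt G (Ici 0) 0 := by
    rw [continuousWithinAt_update_same]
    rwa [Ici_sdiff_left]
  have hGderiv : ∀ t ∈ Ioi (0 : ℝ), HasDerivAt G
      ((√t)⁻¹ * Real.exp (-(b ^ 2 / (2 * t)) - θ ^ 2 / 2 * t)) t := by
    intro t ht
    refine (hderiv t ht).congr_of_eventuallyEq ?_
    filter_upwards [Ioi_mem_nhds (mem_Ioi.1 ht)] with x hx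
    exact Function.update_of_ne (ne_of_gt hx) _ _
  have hGlim : Tendsto G atTop (𝓝 l₁) := by
    refine hlim1.congr' ?_
    filter_upwards [eventually_gt_atTop 0] with x hx
    exact (Function.update_of_ne (ne_of_gt hx) _ _).symm
  have hI := integral_Ioi_of_hasDerivAt_of_nonneg hGcont hGderiv hpos hGlim
  have hInt := integrableOn_Ioi_deriv_of_nonneg hGcont hGderiv hpos hGlim
  rw [← ofReal_integral_eq_lintegral_ofReal hInt
    ((ae_restrict_mem measurableSet_Ioi).mono hpos), hI]
  congr 1
  simp only [G, Function.update_self, l₀, l₁, hC]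
  field_simp
  ring

end InverseLaplace

/-! ### Inverting and estimating a single term of the series. -/

section SmallBall

/-- The function whose Laplace transform at `θ²/2` is proportional to `θ^(-3/2) exp(-bθ)`. -/
noncomputable def kernelTerm (b t : ℝ) : ENNReal :=
  ∫⁻ z in Ioi (0 : ℝ), ENNReal.ofReal
    (z ^ ((1 / 2 : ℝ) - 1) * ((√t)⁻¹ * Real.exp (-((b + z) ^ 2 / (2 * t)))))

lemma measurable_kernelTerm (b : ℝ) : Measurable (kernelTerm b) := by
  unfold kernelTerm
  refine Measurable.lintegral_prod_right' (f := fun p : ℝ × ℝ => ENNReal.ofReal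
    (p.2 ^ ((1 / 2 : ℝ) - 1) * ((√p.1)⁻¹ * Real.exp (-((b + p.2) ^ 2 / (2 * p.1)))))) ?_
  fun_prop

/-- The factor `√(π / θ)` is the integral of `z^(-1/2) exp (-θ z)`. Thus `θ^(-3/2) exp (-b θ)` is,
up to a constant, a mixture over `z` of the functions `θ⁻¹ exp (-(b + z) θ)`, which are inverted by
`lintegral_inv_sqrt_mul_exp`. -/
lemma lintegral_exp_mul_kernelTerm {b θ : ℝ} (hb : 0 < b) (hθ : 0 < θ) :
    ∫⁻ t in Ioi (0 : ℝ), ENNReal.ofReal (Real.exp (-(θ ^ 2 / 2 * t))) * kernelTerm b t =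
      ENNReal.ofReal (√(2 * Real.pi) / θ * √(Real.pi / θ) * Real.exp (-(b * θ))) := by
  have h1 : ∀ t, ENNReal.ofReal (Real.exp (-(θ ^ 2 / 2 * t))) * kernelTerm b t =
      ∫⁻ z in Ioi (0 : ℝ), ENNReal.ofReal (Real.exp (-(θ ^ 2 / 2 * t))) * ENNReal.ofReal
        (z ^ ((1 / 2 : ℝ) - 1) * ((√t)⁻¹ * Real.exp (-((b + z) ^ 2 / (2 * t))))) := by
    intro t
    rw [kernelTerm, lintegral_const_mul _ (by fun_prop)]
  simp_rw [h1]
  rw [lintegral_lintegral_swap (by fun_prop)]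
  have h2 : ∀ z ∈ Ioi (0 : ℝ), ∫⁻ t in Ioi (0 : ℝ), ENNReal.ofReal (Real.exp (-(θ ^ 2 / 2 * t))) *
      ENNReal.ofReal (z ^ ((1 / 2 : ℝ) - 1) * ((√t)⁻¹ * Real.exp (-((b + z) ^ 2 / (2 * t))))) =
      ENNReal.ofReal (√(2 * Real.pi) / θ * Real.exp (-(b * θ))) *
        ENNReal.ofReal (z ^ ((1 / 2 : ℝ) - 1) * Real.exp (-(θ * z))) := by
    intro z hz
    have hz' : 0 < z := hz
    have e : ∀ t, ENNReal.ofReal (Real.exp (-(θ ^ 2 / 2 * t))) *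
        ENNReal.ofReal (z ^ ((1 / 2 : ℝ) - 1) * ((√t)⁻¹ * Real.exp (-((b + z) ^ 2 / (2 * t))))) =
        ENNReal.ofReal (z ^ ((1 / 2 : ℝ) - 1)) * ENNReal.ofReal
          ((√t)⁻¹ * Real.exp (-((b + z) ^ 2 / (2 * t)) - θ ^ 2 / 2 * t)) := by
      intro t
      rw [← ENNReal.ofReal_mul (by positivity), ← ENNReal.ofReal_mul (by positivity),
        sub_eq_add_neg (-((b + z) ^ 2 / (2 * t))), Real.exp_add]
      congr 1
      ring
    simp_rw [e]
    rw [lintegral_const_mul _ (by fun_prop), lintegral_inv_sqrt_mul_exp (by positivity) hθ,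
      ← ENNReal.ofReal_mul (by positivity), ← ENNReal.ofReal_mul (by positivity)]
    congr 1
    have : Real.exp (-((b + z) * θ)) = Real.exp (-(b * θ)) * Real.exp (-(θ * z)) := by
      rw [← Real.exp_add]; congr 1; ring
    rw [this]
    ring
  rw [setLIntegral_congr_fun measurableSet_Ioi h2, lintegral_const_mul _ (by fun_prop),
    lintegral_rpow_mul_exp_neg_mul (by norm_num) hθ, ← ENNReal.ofReal_mul (by positivity),
    Real.Gamma_one_half_eq, ← Real.sqrt_eq_rpow, ← Real.sqrt_mul (by positivity)]
  congr 1
  rw [show 1 / θ * Real.pi = Real.pi / θ by ring]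
  ring

/-- For `2b ≥ 1` and `z > 0` one has `(b + z)² ≥ b² + z`, which leaves a Gamma integral in `z`. -/
lemma kernelTerm_le {b t : ℝ} (hb : 1 / 2 ≤ b) (ht : 0 < t) :
    kernelTerm b t ≤ ENNReal.ofReal (√(2 * Real.pi) * Real.exp (-(b ^ 2 / (2 * t)))) := by
  have h : ∀ z ∈ Ioi (0 : ℝ), ENNReal.ofReal
      (z ^ ((1 / 2 : ℝ) - 1) * ((√t)⁻¹ * Real.exp (-((b + z) ^ 2 / (2 * t))))) ≤
      ENNReal.ofReal ((√t)⁻¹ * Real.exp (-(b ^ 2 / (2 * t)))) *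
        ENNReal.ofReal (z ^ ((1 / 2 : ℝ) - 1) * Real.exp (-(1 / (2 * t) * z))) := by
    intro z hz
    have hz' : 0 < z := hz
    rw [← ENNReal.ofReal_mul (by positivity)]
    refine ENNReal.ofReal_le_ofReal ?_
    have : Real.exp (-((b + z) ^ 2 / (2 * t))) ≤
        Real.exp (-(b ^ 2 / (2 * t))) * Real.exp (-(1 / (2 * t) * z)) := by
      rw [← Real.exp_add, Real.exp_le_exp, ← sub_nonneg]
      have : -(b ^ 2 / (2 * t)) + -(1 / (2 * t) * z) - -((b + z) ^ 2 / (2 * t)) =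
          ((2 * b - 1) * z + z ^ 2) / (2 * t) := by field_simp; ring
      rw [this]
      have : 0 ≤ 2 * b - 1 := by linarith
      positivity
    calc z ^ ((1 / 2 : ℝ) - 1) * ((√t)⁻¹ * Real.exp (-((b + z) ^ 2 / (2 * t))))
        ≤ z ^ ((1 / 2 : ℝ) - 1) * ((√t)⁻¹ *
          (Real.exp (-(b ^ 2 / (2 * t))) * Real.exp (-(1 / (2 * t) * z)))) := by gcongr
      _ = _ := by ring
  refine (setLIntegral_mono' measurableSet_Ioi h).trans_eq ?_
  rw [lintegral_const_mul _ (by fun_prop),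
    lintegral_rpow_mul_exp_neg_mul (by norm_num) (by positivity),
    ← ENNReal.ofReal_mul (by positivity), Real.Gamma_one_half_eq, ← Real.sqrt_eq_rpow,
    one_div_one_div, Real.sqrt_mul zero_le_two, Real.sqrt_mul zero_le_two]
  congr 1
  have := Real.sqrt_pos.2 ht
  field_simp

/-- At `b = 1/2` the upper estimate loses only the factor `exp (-z² / (2t))`, which is at least `1 -
z² / (2t)`. The correction raises the power of `z` by two, whence `Γ(5/2)` and a relative error of
order `t`. -/
lemma le_kernelTerm_half {t : ℝ} (ht : 0 < t) :
    ENNReal.ofReal (Real.exp (-(1 / (8 * t))) *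
      (√(2 * Real.pi) - 2 * √2 * Real.Gamma (5 / 2) * t)) ≤ kernelTerm (1 / 2) t := by
  have hst := Real.sqrt_pos.2 ht
  have h : ∀ z ∈ Ioi (0 : ℝ),
      ENNReal.ofReal ((√t)⁻¹ * Real.exp (-(1 / (8 * t)))) *
        ENNReal.ofReal (z ^ ((1 / 2 : ℝ) - 1) * Real.exp (-(1 / (2 * t) * z))) ≤
      ENNReal.ofReal
        (z ^ ((1 / 2 : ℝ) - 1) * ((√t)⁻¹ * Real.exp (-((1 / 2 + z) ^ 2 / (2 * t))))) +
      ENNReal.ofReal ((√t)⁻¹ * Real.exp (-(1 / (8 * t))) * (1 / (2 * t))) *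
        ENNReal.ofReal (z ^ ((5 / 2 : ℝ) - 1) * Real.exp (-(1 / (2 * t) * z))) := by
    intro z hz
    have hz' : 0 < z := hz
    rw [← ENNReal.ofReal_mul (by positivity), ← ENNReal.ofReal_mul (by positivity),
      ← ENNReal.ofReal_add (by positivity) (by positivity)]
    refine ENNReal.ofReal_le_ofReal ?_
    have e1 : Real.exp (-((1 / 2 + z) ^ 2 / (2 * t))) =
        Real.exp (-(1 / (8 * t))) * Real.exp (-(1 / (2 * t) * z)) *
          Real.exp (-(z ^ 2 / (2 * t))) := by
      rw [← Real.exp_add, ← Real.exp_add]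
      congr 1
      field_simp
      ring
    have e2 : z ^ ((5 / 2 : ℝ) - 1) = z ^ ((1 / 2 : ℝ) - 1) * z ^ 2 := by
      rw [← Real.rpow_natCast z 2, ← Real.rpow_add hz']
      norm_num
    have e3 := Real.add_one_le_exp (-(z ^ 2 / (2 * t)))
    rw [e1, e2]
    have e4 : 0 ≤ z ^ ((1 / 2 : ℝ) - 1) * (√t)⁻¹ * Real.exp (-(1 / (8 * t))) *
      Real.exp (-(1 / (2 * t) * z)) := by positivity
    have e5 := mul_le_mul_of_nonneg_left e3 e4
    have e6 : z ^ 2 / (2 * t) = 1 / (2 * t) * z ^ 2 := by ring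
    rw [e6] at e5 ⊢
    linarith
  have h' := setLIntegral_mono' (μ := volume) measurableSet_Ioi h
  rw [lintegral_add_right _ (by fun_prop), lintegral_const_mul _ (by fun_prop),
    lintegral_const_mul _ (by fun_prop), lintegral_rpow_mul_exp_neg_mul (by norm_num) (by positivity),
    lintegral_rpow_mul_exp_neg_mul (by norm_num) (by positivity),
    ← ENNReal.ofReal_mul (by positivity), ← ENNReal.ofReal_mul (by positivity)] at h'
  have hG : 0 < Real.Gamma (5 / 2) := Real.Gamma_pos_of_pos (by norm_num)
  have a1 : (√t)⁻¹ * Real.exp (-(1 / (8 * t))) *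
      ((1 / (1 / (2 * t))) ^ (1 / 2 : ℝ) * Real.Gamma (1 / 2)) =
      Real.exp (-(1 / (8 * t))) * √(2 * Real.pi) := by
    rw [Real.Gamma_one_half_eq, ← Real.sqrt_eq_rpow, one_div_one_div, Real.sqrt_mul zero_le_two,
      Real.sqrt_mul zero_le_two]
    field_simp
  have a2 : (√t)⁻¹ * Real.exp (-(1 / (8 * t))) * (1 / (2 * t)) *
      ((1 / (1 / (2 * t))) ^ (5 / 2 : ℝ) * Real.Gamma (5 / 2)) =
      Real.exp (-(1 / (8 * t))) * (2 * √2 * Real.Gamma (5 / 2) * t) := by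
    have : (2 * t) ^ (5 / 2 : ℝ) = (2 * t) ^ 2 * (√2 * √t) := by
      rw [← Real.sqrt_mul zero_le_two, Real.sqrt_eq_rpow, ← Real.rpow_natCast (2 * t) 2,
        ← Real.rpow_add (by positivity)]
      norm_num
    rw [one_div_one_div, this]
    field_simp
  rw [a1, a2] at h'
  rw [mul_sub, ENNReal.ofReal_sub _ (by positivity)]
  exact tsub_le_iff_right.2 h'

/-- The Laplace transform of a cumulative distribution function. -/
lemma lintegral_exp_mul_cdf {μ : Measure ℝ} [IsProbabilityMeasure μ] (hμ : ∀ᵐ x ∂μ, 0 ≤ x)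
    {s : ℝ} (hs : 0 < s) :
    ∫⁻ t in Ioi (0 : ℝ), ENNReal.ofReal (Real.exp (-(s * t))) * μ (Iic t) =
      ENNReal.ofReal (1 / s * ∫ x, Real.exp (-(s * x)) ∂μ) := by
  have h1 : ∀ t : ℝ, ENNReal.ofReal (Real.exp (-(s * t))) * μ (Iic t) =
      ∫⁻ x, {p : ℝ × ℝ | p.2 ≤ p.1}.indicator
        (fun p => ENNReal.ofReal (Real.exp (-(s * p.1)))) (t, x) ∂μ := by
    intro t
    have : ∀ x, {p : ℝ × ℝ | p.2 ≤ p.1}.indicator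
        (fun p => ENNReal.ofReal (Real.exp (-(s * p.1)))) (t, x) =
        (Iic t).indicator (fun _ => ENNReal.ofReal (Real.exp (-(s * t)))) x := by
      intro x
      simp [indicator]
    simp_rw [this]
    rw [lintegral_indicator_const measurableSet_Iic]
  have hmeas : Measurable ({p : ℝ × ℝ | p.2 ≤ p.1}.indicator
        (fun p => ENNReal.ofReal (Real.exp (-(s * p.1))))) :=
    Measurable.indicator (by fun_prop) (measurableSet_le measurable_snd measurable_fst)
  simp_rw [h1]
  rw [lintegral_lintegral_swap (f := fun t x => {p : ℝ × ℝ | p.2 ≤ p.1}.indicator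
    (fun p => ENNReal.ofReal (Real.exp (-(s * p.1)))) (t, x)) hmeas.aemeasurable]
  have h2 : ∀ᵐ x ∂μ, ∫⁻ t in Ioi (0 : ℝ), {p : ℝ × ℝ | p.2 ≤ p.1}.indicator
      (fun p => ENNReal.ofReal (Real.exp (-(s * p.1)))) (t, x) =
      ENNReal.ofReal (1 / s * Real.exp (-(s * x))) := by
    filter_upwards [hμ] with x hx
    have e : ∀ t, {p : ℝ × ℝ | p.2 ≤ p.1}.indicator
        (fun p => ENNReal.ofReal (Real.exp (-(s * p.1)))) (t, x) =
        (Ici x).indicator (fun t => ENNReal.ofReal (Real.exp (-s * t))) t := by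
      intro t
      simp [indicator]
    simp_rw [e]
    rw [setLIntegral_indicator measurableSet_Ici]
    -- The sets differ at most at the point `x`; intersecting with `Ioi 0` costs nothing more since
    -- `0 ≤ x`.
    have hset : (Ici x ∩ Ioi 0 : Set ℝ) =ᵐ[volume] Ioi x := by
      have : (Ioi x ∩ Ioi 0 : Set ℝ) = Ioi x := inter_eq_left.2 (Ioi_subset_Ioi hx)
      conv_rhs => rw [← this]
      exact Ioi_ae_eq_Ici.symm.inter (ae_eq_refl _)
    rw [setLIntegral_congr hset, ← ofReal_integral_eq_lintegral_ofReal
      (integrableOn_exp_mul_Ioi (by linarith) x) (ae_of_all _ fun _ => Real.exp_nonneg _),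
      integral_exp_mul_Ioi (by linarith)]
    congr 1
    rw [neg_mul]
    field_simp
  rw [lintegral_congr_ae h2, ← integral_const_mul, ofReal_integral_eq_lintegral_ofReal]
  · refine Integrable.const_mul (Integrable.of_bound (C := 1) (by fun_prop) ?_) _
    filter_upwards [hμ] with x hx
    rw [Real.norm_of_nonneg (Real.exp_nonneg _), Real.exp_le_one_iff]
    nlinarith
  · exact ae_of_all _ fun x => by positivity

end SmallBall

/-! ### The distribution function as a series, and its behaviour at zero. -/

section SmallBallAsymptotics

/-- This rests on `sinh θ = exp θ * (1 - exp (-2θ)) / 2`; the last factor is the one expanded by the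
binomial series. -/
lemma sqrt_div_sinh_eq {θ : ℝ} (hθ : 0 < θ) :
    √(θ / Real.sinh θ) =
      √2 * √θ * Real.exp (-(1 / 2 * θ)) * (√(1 - Real.exp (-(2 * θ))))⁻¹ := by
  have h1 : Real.exp (-(2 * θ)) < 1 := Real.exp_lt_one_iff.2 (by linarith)
  have hq : 0 < 1 - Real.exp (-(2 * θ)) := by linarith
  have hS := Real.sinh_pos_iff.2 hθ
  rw [Real.sqrt_eq_iff_mul_self_eq (by positivity) (by positivity)]
  have e1 : √2 * √θ * Real.exp (-(1 / 2 * θ)) * (√(1 - Real.exp (-(2 * θ))))⁻¹ *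
      (√2 * √θ * Real.exp (-(1 / 2 * θ)) * (√(1 - Real.exp (-(2 * θ))))⁻¹) =
      (√2 * √2) * (√θ * √θ) * (Real.exp (-(1 / 2 * θ)) * Real.exp (-(1 / 2 * θ))) *
        (√(1 - Real.exp (-(2 * θ))) * √(1 - Real.exp (-(2 * θ))))⁻¹ := by
    rw [mul_inv]; ring
  rw [e1, Real.mul_self_sqrt zero_le_two, Real.mul_self_sqrt hθ.le, Real.mul_self_sqrt hq.le,
    ← Real.exp_add, ← div_eq_mul_inv, div_eq_div_iff hS.ne' hq.ne', Real.sinh_eq]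
  have e2 : Real.exp (-(1 / 2 * θ) + -(1 / 2 * θ)) = Real.exp (-θ) := by congr 1; ring
  have e3 : Real.exp (-(2 * θ)) = Real.exp (-θ) * Real.exp (-θ) := by
    rw [← Real.exp_add]; congr 1; ring
  have e4 : Real.exp (-θ) * Real.exp θ = 1 := by rw [← Real.exp_add]; simp
  rw [e2, e3]
  linear_combination -θ * e4

/-- The series representation of the distribution function of the squared norm. -/
noncomputable def cdfSeries (c : ℕ → ℝ) (t : ℝ) : ENNReal :=
  ∑' k : ℕ, ENNReal.ofReal (2 / Real.pi * c k) * kernelTerm (2 * k + 1 / 2) t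

lemma measurable_cdfSeries (c : ℕ → ℝ) : Measurable (cdfSeries c) :=
  Measurable.tsum fun _ => (measurable_kernelTerm _).const_mul _

variable {c : ℕ → ℝ}

lemma lintegral_exp_mul_cdfSeries (hc : ∀ k, 0 ≤ c k)
    (hs : ∀ q : ℝ, 0 ≤ q → q < 1 → HasSum (fun k => c k * q ^ k) (√(1 - q))⁻¹)
    {θ : ℝ} (hθ : 0 < θ) :
    ∫⁻ t in Ioi (0 : ℝ), ENNReal.ofReal (Real.exp (-(θ ^ 2 / 2 * t))) * cdfSeries c t =
      ENNReal.ofReal (1 / (θ ^ 2 / 2) * √(θ / Real.sinh θ)) := by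
  have h1 : ∀ t, ENNReal.ofReal (Real.exp (-(θ ^ 2 / 2 * t))) * cdfSeries c t =
      ∑' k : ℕ, ENNReal.ofReal (2 / Real.pi * c k) *
        (ENNReal.ofReal (Real.exp (-(θ ^ 2 / 2 * t))) * kernelTerm (2 * k + 1 / 2) t) := by
    intro t
    rw [cdfSeries, ← ENNReal.tsum_mul_left]
    refine tsum_congr fun k => ?_
    ring
  simp_rw [h1]
  have hm : ∀ k : ℕ, Measurable (fun t => ENNReal.ofReal (Real.exp (-(θ ^ 2 / 2 * t))) *
      kernelTerm (2 * k + 1 / 2) t) := fun k =>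
    Measurable.mul (by fun_prop) (measurable_kernelTerm _)
  rw [lintegral_tsum fun k => ((hm k).const_mul _).aemeasurable]
  set A := √(2 * Real.pi) / θ * √(Real.pi / θ) with hA
  have h2 : ∀ k : ℕ, ∫⁻ t in Ioi (0 : ℝ), ENNReal.ofReal (2 / Real.pi * c k) *
      (ENNReal.ofReal (Real.exp (-(θ ^ 2 / 2 * t))) * kernelTerm (2 * k + 1 / 2) t) =
      ENNReal.ofReal (2 / Real.pi * A * Real.exp (-(1 / 2 * θ)) *
        (c k * Real.exp (-(2 * θ)) ^ k)) := by
    intro k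
    have := hc k
    have hpi := Real.pi_pos
    rw [lintegral_const_mul _ (hm k), lintegral_exp_mul_kernelTerm (by positivity) hθ,
      ← ENNReal.ofReal_mul (by positivity)]
    congr 1
    have e : Real.exp (-((2 * (k : ℝ) + 1 / 2) * θ)) =
        Real.exp (-(1 / 2 * θ)) * Real.exp (-(2 * θ)) ^ k := by
      rw [← Real.exp_nat_mul, ← Real.exp_add]; congr 1; ring
    rw [e]
    ring
  simp_rw [h2]
  have hsum := (hs (Real.exp (-(2 * θ))) (Real.exp_nonneg _)
    (Real.exp_lt_one_iff.2 (by linarith))).mul_left (2 / Real.pi * A * Real.exp (-(1 / 2 * θ)))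
  rw [← ENNReal.ofReal_tsum_of_nonneg _ hsum.summable, hsum.tsum_eq, sqrt_div_sinh_eq hθ]
  · congr 1
    have e : 2 / Real.pi * A = 1 / (θ ^ 2 / 2) * (√2 * √θ) := by
      have hpi := Real.sqrt_pos.2 Real.pi_pos
      have hth := Real.sqrt_pos.2 hθ
      rw [hA, Real.sqrt_mul zero_le_two, Real.sqrt_div Real.pi_pos.le]
      have e1 : Real.pi = √Real.pi ^ 2 := (Real.sq_sqrt Real.pi_pos.le).symm
      have e2 : √θ ^ 2 = θ := Real.sq_sqrt hθ.le
      have e3 : 2 / Real.pi = 2 / √Real.pi ^ 2 := by rw [← e1]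
      rw [e3]
      field_simp
      linear_combination -e2
    rw [e]
    ring
  · intro k
    have := hc k
    have hpi := Real.pi_pos
    positivity

/-- A distribution on `[0, ∞)` with the Laplace transform `√(θ / sinh θ)` at `θ²/2` has the
distribution function `cdfSeries`. -/
lemma ae_cdf_eq_cdfSeries (hc : ∀ k, 0 ≤ c k)
    (hs : ∀ q : ℝ, 0 ≤ q → q < 1 → HasSum (fun k => c k * q ^ k) (√(1 - q))⁻¹)
    {μ : Measure ℝ} [IsProbabilityMeasure μ] (hμ : ∀ᵐ x ∂μ, 0 ≤ x)
    (hL : ∀ θ : ℝ, 0 < θ → ∫ x, Real.exp (-(θ ^ 2 / 2) * x) ∂μ = √(θ / Real.sinh θ)) :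
    ∀ᵐ t ∂(volume.restrict (Ioi (0 : ℝ))), μ (Iic t) = cdfSeries c t := by
  set ρ := volume.restrict (Ioi (0 : ℝ))
  have hmono : Monotone fun t => μ (Iic t) := fun a b hab => measure_mono (Iic_subset_Iic.2 hab)
  have hcdf : Measurable (fun t => μ (Iic t)) := hmono.measurable
  have hlap : ∀ s : ℝ, 0 < s → ∫⁻ t, ENNReal.ofReal (Real.exp (-(s * t))) * μ (Iic t) ∂ρ =
      ∫⁻ t, ENNReal.ofReal (Real.exp (-(s * t))) * cdfSeries c t ∂ρ := by
    intro s hs0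
    have hθ : 0 < √(2 * s) := Real.sqrt_pos.2 (by positivity)
    have e : s = √(2 * s) ^ 2 / 2 := by rw [Real.sq_sqrt (by positivity)]; ring
    rw [lintegral_exp_mul_cdf hμ hs0]
    have h2 := lintegral_exp_mul_cdfSeries hc hs hθ
    have h3 := hL _ hθ
    rw [← e] at h2 h3
    rw [h2, ← h3]
    simp only [neg_mul]
  have hfin : ∫⁻ t, ENNReal.ofReal (Real.exp (-(1 * t))) * μ (Iic t) ∂ρ ≠ ⊤ := by
    rw [lintegral_exp_mul_cdf hμ one_pos]
    exact ENNReal.ofReal_ne_top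
  -- A distribution function is not integrable on the half-line, so both sides are weighted by `exp
  -- (-t)` to give finite measures. The weight shifts the Laplace argument from `n` to `n + 1`,
  -- which also avoids the argument `0`.
  set f := fun t => ENNReal.ofReal (Real.exp (-(1 * t))) * μ (Iic t)
  set g := fun t => ENNReal.ofReal (Real.exp (-(1 * t))) * cdfSeries c t
  have hf : Measurable f := Measurable.mul (by fun_prop) hcdf
  have hg : Measurable g := Measurable.mul (by fun_prop) (measurable_cdfSeries c)
  have hfinf : IsFiniteMeasure (ρ.withDensity f) := isFiniteMeasure_withDensity hfin
  have hfing : IsFiniteMeasure (ρ.withDensity g) :=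
    isFiniteMeasure_withDensity (by rw [← hlap 1 one_pos]; exact hfin)
  have hpos : ∀ᵐ t ∂ρ, 0 ≤ t := (ae_restrict_mem measurableSet_Ioi).mono fun t ht => le_of_lt ht
  have hshift : ∀ (n : ℕ) (F : ℝ → ENNReal) (t : ℝ),
      ENNReal.ofReal (Real.exp (-(1 * t))) * F t * ENNReal.ofReal (Real.exp (-(n * t))) =
        ENNReal.ofReal (Real.exp (-((n + 1 : ℝ) * t))) * F t := by
    intro n F t
    have : Real.exp (-((n + 1 : ℝ) * t)) = Real.exp (-(1 * t)) * Real.exp (-(n * t)) := by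
      rw [← Real.exp_add]; congr 1; ring
    rw [this, ENNReal.ofReal_mul (Real.exp_nonneg _)]
    ring
  have heq : ρ.withDensity f = ρ.withDensity g := by
    refine measure_ext_of_lintegral_exp ?_ ?_ fun n => ?_
    · exact (withDensity_absolutelyContinuous ρ f).ae_le hpos
    · exact (withDensity_absolutelyContinuous ρ g).ae_le hpos
    · rw [lintegral_withDensity_eq_lintegral_mul _ hf (by fun_prop),
        lintegral_withDensity_eq_lintegral_mul _ hg (by fun_prop)]
      simp only [Pi.mul_apply, f, g, hshift n (fun t => μ (Iic t)), hshift n (cdfSeries c)]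
      exact hlap _ (by positivity)
  have hae := (withDensity_eq_iff hf.aemeasurable hg.aemeasurable hfin).1 heq
  filter_upwards [hae] with t ht
  exact (ENNReal.mul_right_inj (by simp [Real.exp_pos]) ENNReal.ofReal_ne_top).1 ht

lemma two_div_pi_mul_sqrt : 2 / Real.pi * √(2 * Real.pi) = √(8 / Real.pi) := by
  have hpi := Real.pi_pos
  rw [eq_comm, Real.sqrt_eq_iff_mul_self_eq (by positivity) (by positivity)]
  have : 2 / Real.pi * √(2 * Real.pi) * (2 / Real.pi * √(2 * Real.pi)) =
      (2 / Real.pi) ^ 2 * (√(2 * Real.pi) * √(2 * Real.pi)) := by ring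
  rw [this, Real.mul_self_sqrt (by positivity)]
  field_simp
  norm_num

/-- The exponent `(2k + 1/2)² / (2t)` equals `1/(8t) + k/t + 2k²/t`. Discarding the last summand
leaves powers of `exp (-1/t)`, and the binomial series can be summed again. -/
lemma cdfSeries_le (hc : ∀ k, 0 ≤ c k)
    (hs : ∀ q : ℝ, 0 ≤ q → q < 1 → HasSum (fun k => c k * q ^ k) (√(1 - q))⁻¹)
    {t : ℝ} (ht : 0 < t) :
    cdfSeries c t ≤ ENNReal.ofReal (√(8 / Real.pi) * Real.exp (-(1 / (8 * t))) *
      (√(1 - Real.exp (-(1 / t))))⁻¹) := by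
  have hpi := Real.pi_pos
  have hsum := (hs (Real.exp (-(1 / t))) (Real.exp_nonneg _)
    (Real.exp_lt_one_iff.2 (by simp [ht]))).mul_left (√(8 / Real.pi) * Real.exp (-(1 / (8 * t))))
  rw [← hsum.tsum_eq, ENNReal.ofReal_tsum_of_nonneg (fun k => by have := hc k; positivity)
    hsum.summable]
  refine ENNReal.tsum_le_tsum fun k => ?_
  have hck := hc k
  refine (mul_le_mul_right (kernelTerm_le (b := 2 * k + 1 / 2) (t := t)
    (by have : (0 : ℝ) ≤ k := Nat.cast_nonneg k
        linarith) ht) _).trans ?_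
  rw [← ENNReal.ofReal_mul (by positivity), ← two_div_pi_mul_sqrt]
  refine ENNReal.ofReal_le_ofReal ?_
  have : Real.exp (-((2 * (k : ℝ) + 1 / 2) ^ 2 / (2 * t))) ≤
      Real.exp (-(1 / (8 * t))) * Real.exp (-(1 / t)) ^ k := by
    rw [← Real.exp_nat_mul, ← Real.exp_add, Real.exp_le_exp, ← sub_nonneg]
    have : -(1 / (8 * t)) + (k : ℝ) * -(1 / t) - -((2 * (k : ℝ) + 1 / 2) ^ 2 / (2 * t)) =
        2 * (k : ℝ) ^ 2 / t := by field_simp; ring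
    rw [this]
    positivity
  calc 2 / Real.pi * c k * (√(2 * Real.pi) * Real.exp (-((2 * (k : ℝ) + 1 / 2) ^ 2 / (2 * t))))
      ≤ 2 / Real.pi * c k * (√(2 * Real.pi) *
        (Real.exp (-(1 / (8 * t))) * Real.exp (-(1 / t)) ^ k)) := by gcongr
    _ = _ := by ring

/-- All terms are nonnegative, so the term `k = 0` alone bounds the series from below. -/
lemma le_cdfSeries (hc0 : c 0 = 1) {t : ℝ} (ht : 0 < t) :
    ENNReal.ofReal (Real.exp (-(1 / (8 * t))) *
      (√(8 / Real.pi) - 2 / Real.pi * (2 * √2 * Real.Gamma (5 / 2)) * t)) ≤ cdfSeries c t := by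
  refine le_trans ?_ (ENNReal.le_tsum 0)
  have hpi := Real.pi_pos
  have h := mul_le_mul_right (le_kernelTerm_half ht) (ENNReal.ofReal (2 / Real.pi))
  rw [← ENNReal.ofReal_mul (by positivity)] at h
  simp only [hc0, Nat.cast_zero, mul_zero, zero_add, mul_one]
  refine le_trans (le_of_eq ?_) h
  congr 1
  rw [← two_div_pi_mul_sqrt]
  ring

/-- Two-sided bounds, for every radius, on a distribution with Laplace transform
`√(θ / sinh θ)` at `θ²/2`. -/
lemma exists_cdf_bounds {μ : Measure ℝ} [IsProbabilityMeasure μ] (hμ : ∀ᵐ x ∂μ, 0 ≤ x)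
    (hL : ∀ θ : ℝ, 0 < θ → ∫ x, Real.exp (-(θ ^ 2 / 2) * x) ∂μ = √(θ / Real.sinh θ)) :
    ∃ C : ℝ, ∀ t : ℝ, 0 < t →
      Real.exp (-(1 / (8 * t))) * (√(8 / Real.pi) - C * t) ≤ μ.real (Iic t) ∧
      μ.real (Iic t) ≤
        √(8 / Real.pi) * Real.exp (-(1 / (8 * t))) * (√(1 - Real.exp (-(1 / t))))⁻¹ := by
  obtain ⟨c, hc0, hc, hs⟩ := exists_inv_sqrt_one_sub_series
  refine ⟨2 / Real.pi * (2 * √2 * Real.Gamma (5 / 2)), ?_⟩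
  set C := 2 / Real.pi * (2 * √2 * Real.Gamma (5 / 2))
  have hpi := Real.pi_pos
  have hae := (ae_restrict_iff' measurableSet_Ioi).1 (ae_cdf_eq_cdfSeries hc hs hμ hL)
  -- The series formula holds only almost everywhere, hence on a dense set. By monotonicity and
  -- continuity of the bounds, points to the left of `t` yield the lower bound at `t` and points to
  -- the right the upper one.
  have hdense := Measure.dense_of_ae hae
  have hmono : ∀ a b : ℝ, a ≤ b → μ.real (Iic a) ≤ μ.real (Iic b) := fun a b hab =>
    measureReal_mono (Iic_subset_Iic.2 hab)
  set l : ℝ → ℝ := fun t => Real.exp (-(1 / (8 * t))) * (√(8 / Real.pi) - C * t)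
  set u : ℝ → ℝ := fun t =>
    √(8 / Real.pi) * Real.exp (-(1 / (8 * t))) * (√(1 - Real.exp (-(1 / t))))⁻¹
  have hlu : ∀ t, (t ∈ Ioi (0 : ℝ) → μ (Iic t) = cdfSeries c t) → 0 < t →
      l t ≤ μ.real (Iic t) ∧ μ.real (Iic t) ≤ u t := by
    intro t ht ht0
    have h := ht ht0
    constructor
    · have := le_cdfSeries (c := c) hc0 ht0
      rw [← h] at this
      exact (ENNReal.ofReal_le_iff_le_toReal (measure_ne_top μ _)).1 this
    · have := cdfSeries_le hc hs ht0
      rw [← h] at this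
      exact ENNReal.toReal_le_of_le_ofReal (by positivity) this
  intro t ht
  have hlc : ContinuousAt l t := by
    have : 8 * t ≠ 0 := by positivity
    fun_prop (disch := assumption)
  have huc : ContinuousAt u t := by
    have h1 : t ≠ 0 := ht.ne'
    have h2 : 8 * t ≠ 0 := by positivity
    have h3 : Real.exp (-(1 / t)) < 1 := Real.exp_lt_one_iff.2 (by simp [ht])
    have h4 : √(1 - Real.exp (-(1 / t))) ≠ 0 := (Real.sqrt_pos.2 (by linarith)).ne'
    fun_prop (disch := assumption)
  constructor
  · have hcl : t ∈ closure (Ioo 0 t ∩ {x | x ∈ Ioi (0 : ℝ) → μ (Iic x) = cdfSeries c x}) := by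
      have := hdense.open_subset_closure_inter (isOpen_Ioo (a := 0) (b := t))
      refine closure_minimal this isClosed_closure ?_
      rw [closure_Ioo ht.ne]
      exact ⟨ht.le, le_rfl⟩
    refine le_of_tendsto_of_frequently hlc ?_
    refine (mem_closure_iff_frequently.1 hcl).mono fun x hx => ?_
    exact (hlu x hx.2 hx.1.1).1.trans (hmono x t hx.1.2.le)
  · have hcl : t ∈ closure (Ioi t ∩ {x | x ∈ Ioi (0 : ℝ) → μ (Iic x) = cdfSeries c x}) := by
      have := hdense.open_subset_closure_inter (isOpen_Ioi (a := t))
      refine closure_minimal this isClosed_closure ?_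
      rw [closure_Ioi]
      exact self_mem_Ici
    refine ge_of_tendsto_of_frequently huc ?_
    refine (mem_closure_iff_frequently.1 hcl).mono fun x hx => ?_
    exact (hmono t x (le_of_lt hx.1)).trans (hlu x hx.2 (ht.trans hx.1)).2

/-- Exact small ball asymptotics from the Laplace transform. -/
lemma isEquivalent_cdf {μ : Measure ℝ} [IsProbabilityMeasure μ] (hμ : ∀ᵐ x ∂μ, 0 ≤ x)
    (hL : ∀ θ : ℝ, 0 < θ → ∫ x, Real.exp (-(θ ^ 2 / 2) * x) ∂μ = √(θ / Real.sinh θ)) :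
    (fun t : ℝ => μ.real (Iic t)) ~[𝓝[>] 0]
      (fun t : ℝ => √(8 / Real.pi) * Real.exp (-(1 / (8 * t)))) := by
  have hpi := Real.pi_pos
  obtain ⟨C, hC⟩ := exists_cdf_bounds hμ hL
  set A := √(8 / Real.pi)
  have hA : 0 < A := Real.sqrt_pos.2 (by positivity)
  rw [Asymptotics.isEquivalent_iff_tendsto_one (Eventually.of_forall fun t => by positivity)]
  have hlow : Tendsto (fun t : ℝ => 1 - C / A * t) (𝓝[>] 0) (𝓝 1) := by
    have : Tendsto (fun t : ℝ => 1 - C / A * t) (𝓝 0) (𝓝 (1 - C / A * 0)) :=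
      Continuous.tendsto (by fun_prop) 0
    rw [mul_zero, sub_zero] at this
    exact this.mono_left nhdsWithin_le_nhds
  have hup : Tendsto (fun t : ℝ => (√(1 - Real.exp (-(1 / t))))⁻¹) (𝓝[>] 0) (𝓝 1) := by
    have h1 : Tendsto (fun t : ℝ => Real.exp (-(1 / t))) (𝓝[>] 0) (𝓝 0) := by
      refine Real.tendsto_exp_neg_atTop_nhds_zero.comp ?_
      refine tendsto_inv_nhdsGT_zero.congr fun t => ?_
      rw [one_div]
    have h2 := ((h1.const_sub 1).sqrt).inv₀ (by simp)
    simpa using h2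
  refine tendsto_of_tendsto_of_tendsto_of_le_of_le' hlow hup ?_ ?_
  · filter_upwards [self_mem_nhdsWithin] with t ht
    rw [Pi.div_apply, le_div_iff₀ (by positivity)]
    refine le_trans (le_of_eq ?_) (hC t ht).1
    field_simp
  · filter_upwards [self_mem_nhdsWithin] with t ht
    rw [Pi.div_apply, div_le_iff₀ (by positivity)]
    refine (hC t ht).2.trans (le_of_eq ?_)
    ring

end SmallBallAsymptotics

/-! ### Transfer to the processes, and the theorem. -/

section Main

set_option linter.unusedSectionVars false

variable {Ω : Type*} [MeasurableSpace Ω] {P : Measure Ω} [IsProbabilityMeasure P]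

lemma isProbabilityMeasure_map_sqNorm {Y : ℝ → Ω → ℝ}
    (h2 : MemLp (Function.uncurry Y) 2 (unitVolume.prod P)) :
    IsProbabilityMeasure (P.map (sqNorm Y)) :=
  Measure.isProbabilityMeasure_map
    (IsCenteredGaussianOnUnit.integrable_sqNorm h2).aestronglyMeasurable.aemeasurable

lemma ae_nonneg_map_sqNorm {Y : ℝ → Ω → ℝ} (hm : AEMeasurable (sqNorm Y) P) :
    ∀ᵐ x ∂(P.map (sqNorm Y)), 0 ≤ x :=
  (ae_map_iff hm measurableSet_Ici).2 (ae_of_all _ fun ω => sqNorm_nonneg Y ω)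

lemma measureReal_pathNorm_le {Y : ℝ → Ω → ℝ} (hm : AEMeasurable (sqNorm Y) P) {ε : ℝ}
    (hε : 0 ≤ ε) : P.real {ω | pathNorm Y ω ≤ ε} = (P.map (sqNorm Y)).real (Iic (ε ^ 2)) := by
  rw [measureReal_def, measureReal_def, Measure.map_apply_of_aemeasurable hm measurableSet_Iic]
  congr 2
  ext ω
  simp only [mem_ofPred_eq, mem_preimage, mem_Iic, pathNorm_eq_sqrt_sqNorm]
  exact Real.sqrt_le_left hε

/-- A process with almost surely continuous paths and measurable values is jointly measurable. -/
lemma aemeasurable_uncurry_of_continuous {X : ℝ → Ω → ℝ} (hm : ∀ t, AEMeasurable (X t) P)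
    (hc : ∀ᵐ ω ∂P, Continuous (X · ω)) : AEMeasurable (Function.uncurry X) (unitVolume.prod P) := by
  -- Outside the measurable null set `N` paths are continuous and agree at all rational times with
  -- measurable versions. Setting the process to zero on `N` makes it measurable at rational times,
  -- then at all times by limits, and jointly by path continuity.
  obtain ⟨N, hNsub, hNmeas, hN0⟩ :=
    exists_measurable_superset_of_null (show P {ω | ¬ (Continuous (X · ω) ∧
      ∀ q : ℚ, X q ω = (hm q).mk (X q) ω)} = 0 from by
        have : ∀ᵐ ω ∂P, ∀ q : ℚ, X q ω = (hm q).mk (X q) ω :=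
          ae_all_iff.2 fun q => (hm q).ae_eq_mk
        exact (hc.and this))
  have hgood : ∀ ω ∉ N, Continuous (X · ω) ∧ ∀ q : ℚ, X q ω = (hm q).mk (X q) ω := by
    intro ω hω
    by_contra h
    exact hω (hNsub h)
  let Z : ℝ → Ω → ℝ := fun t => Nᶜ.indicator (X t)
  have hZc : ∀ ω, Continuous (fun t => Z t ω) := by
    intro ω
    by_cases hω : ω ∈ N
    · have : (fun t => Z t ω) = fun _ => 0 := by
        funext t; exact indicator_of_notMem (by simpa using hω) _
      rw [this]; exact continuous_const
    · have : (fun t => Z t ω) = fun t => X t ω := by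
        funext t; exact indicator_of_mem (by simpa using hω) _
      rw [this]; exact (hgood ω hω).1
  have hZq : ∀ q : ℚ, Measurable (Z q) := by
    intro q
    have : Z q = Nᶜ.indicator ((hm q).mk (X q)) := by
      funext ω
      by_cases hω : ω ∈ N
      · simp [Z, hω]
      · simp [Z, hω, (hgood ω hω).2 q]
    rw [this]
    exact (hm q).measurable_mk.indicator hNmeas.compl
  have hZm : ∀ t, Measurable (Z t) := by
    intro t
    obtain ⟨u, hu, hlim⟩ := mem_closure_iff_seq_limit.1 (Rat.denseRange_cast (𝕜 := ℝ) t)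
    choose q hq using hu
    refine measurable_of_tendsto_metrizable (fun n => hZq (q n)) (tendsto_pi_nhds.2 fun ω => ?_)
    simp_rw [hq]
    exact ((hZc ω).tendsto t).comp hlim
  have hZ : Measurable (Function.uncurry Z) :=
    measurable_uncurry_of_continuous_of_measurable hZc hZm
  refine ⟨Function.uncurry Z, hZ, ?_⟩
  have hae : ∀ᵐ ω ∂P, ω ∉ N := measure_eq_zero_iff_ae_notMem.1 hN0
  have := Measure.quasiMeasurePreserving_snd (μ := unitVolume) (ν := P) |>.ae hae
  filter_upwards [this] with p hp
  simp [Function.uncurry, Z, hp]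

lemma isCenteredGaussianOnUnit_onUnit {W : NNReal → Ω → ℝ} (hW : IsBrownianReal W P) :
    IsCenteredGaussianOnUnit (onUnit W) P where
  gaussian := hW.isGaussianProcess.comp_right fun t : Icc (0 : ℝ) 1 => (t : ℝ).toNNReal
  mean_zero t _ := hW.integral_eval _
  aemeasurable := by
    refine aemeasurable_uncurry_of_continuous (fun t => hW.aemeasurable _) ?_
    filter_upwards [hW.cont] with ω hω
    exact hω.comp continuous_real_toNNReal

lemma covKernel_onUnit {W : NNReal → Ω → ℝ} (hW : IsBrownianReal W P) :
    ∀ t ∈ Icc (0 : ℝ) 1, ∀ s ∈ Icc (0 : ℝ) 1, covKernel (onUnit W) P t s = min t s := by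
  intro t ht s hs
  have hm : ∀ r, MemLp (W r) 2 P := fun r => (hW.isGaussianProcess.hasGaussianLaw_eval r).memLp_two
  have h := hW.covariance_eval t.toNNReal s.toNNReal
  rw [covariance_eq_sub (hm _) (hm _), hW.integral_eval, zero_mul, sub_zero] at h
  have h' : covKernel (onUnit W) P t s = ∫ ω, (W t.toNNReal * W s.toNNReal) ω ∂P := rfl
  rw [h', h]
  push_cast
  rw [Real.coe_toNNReal _ ht.1, Real.coe_toNNReal _ hs.1]

lemma integral_exp_map_sqNorm {Y : ℝ → Ω → ℝ} (hY : IsCenteredGaussianOnUnit Y P)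
    (hK : ∀ t ∈ Icc (0 : ℝ) 1, ∀ s ∈ Icc (0 : ℝ) 1, covKernel Y P t s = neumannKernel t s)
    (θ : ℝ) (hθ : 0 < θ) :
    ∫ x, Real.exp (-(θ ^ 2 / 2) * x) ∂(P.map (sqNorm Y)) = √(θ / Real.sinh θ) := by
  have hm := IsCenteredGaussianOnUnit.integrable_sqNorm (hY.memLp_uncurry_of_neumannKernel hK)
  rw [integral_map hm.aestronglyMeasurable.aemeasurable (by fun_prop)]
  exact hY.integral_exp_neg_mul_sqNorm hK hθ

/-- The law of the squared norm is determined by the covariance `neumannKernel`. -/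
lemma identDistrib_sqNorm {Ω' : Type*} [MeasurableSpace Ω'] {P' : Measure Ω'}
    [IsProbabilityMeasure P'] {Y : ℝ → Ω → ℝ} {Y' : ℝ → Ω' → ℝ}
    (hY : IsCenteredGaussianOnUnit Y P)
    (hK : ∀ t ∈ Icc (0 : ℝ) 1, ∀ s ∈ Icc (0 : ℝ) 1, covKernel Y P t s = neumannKernel t s)
    (hY' : IsCenteredGaussianOnUnit Y' P')
    (hK' : ∀ t ∈ Icc (0 : ℝ) 1, ∀ s ∈ Icc (0 : ℝ) 1, covKernel Y' P' t s = neumannKernel t s) :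
    IdentDistrib (sqNorm Y) (sqNorm Y') P P' := by
  have h2 := hY.memLp_uncurry_of_neumannKernel hK
  have h2' := hY'.memLp_uncurry_of_neumannKernel hK'
  have hm := (IsCenteredGaussianOnUnit.integrable_sqNorm h2).aestronglyMeasurable.aemeasurable
  have hm' := (IsCenteredGaussianOnUnit.integrable_sqNorm h2').aestronglyMeasurable.aemeasurable
  have hp := isProbabilityMeasure_map_sqNorm h2
  have hp' := isProbabilityMeasure_map_sqNorm h2'
  refine ⟨hm, hm', ?_⟩
  -- The transform at `n` corresponds to `θ = √(2n)`; the case `n = 0`, where the formula in `θ` is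
  -- unavailable, is the total mass.
  have key : ∀ {μ : Measure ℝ} [IsProbabilityMeasure μ], (∀ᵐ x ∂μ, 0 ≤ x) →
      (∀ θ : ℝ, 0 < θ → ∫ x, Real.exp (-(θ ^ 2 / 2) * x) ∂μ = √(θ / Real.sinh θ)) →
      ∀ n : ℕ, ∫⁻ x, ENNReal.ofReal (Real.exp (-(n * x))) ∂μ =
        if n = 0 then 1 else ENNReal.ofReal √(√(2 * n) / Real.sinh √(2 * n)) := by
    intro μ _ hμ hL n
    split_ifs with hn
    · simp [hn]
    · have hn' : (0 : ℝ) < n := by exact_mod_cast Nat.pos_of_ne_zero hn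
      have h := hL √(2 * n) (Real.sqrt_pos.2 (by positivity))
      rw [Real.sq_sqrt (by positivity), mul_div_cancel_left₀ _ two_ne_zero] at h
      rw [← h]
      simp only [neg_mul]
      rw [ofReal_integral_eq_lintegral_ofReal _ (ae_of_all _ fun x => Real.exp_nonneg _)]
      refine Integrable.of_bound (C := 1) (by fun_prop) ?_
      filter_upwards [hμ] with x hx
      rw [Real.norm_of_nonneg (Real.exp_nonneg _), Real.exp_le_one_iff]
      nlinarith
  refine measure_ext_of_lintegral_exp (ae_nonneg_map_sqNorm hm) (ae_nonneg_map_sqNorm hm')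
    fun n => ?_
  rw [key (ae_nonneg_map_sqNorm hm) (integral_exp_map_sqNorm hY hK),
    key (ae_nonneg_map_sqNorm hm') (integral_exp_map_sqNorm hY' hK')]

/-- Small ball asymptotics of a centered Gaussian process with covariance `neumannKernel`. -/
lemma isEquivalent_measureReal_pathNorm_le {Y : ℝ → Ω → ℝ} (hY : IsCenteredGaussianOnUnit Y P)
    (hK : ∀ t ∈ Icc (0 : ℝ) 1, ∀ s ∈ Icc (0 : ℝ) 1, covKernel Y P t s = neumannKernel t s) :
    (fun ε : ℝ => P.real {ω | pathNorm Y ω ≤ ε}) ~[𝓝[>] 0]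
      (fun ε : ℝ => (8 / Real.pi) ^ (1 / 2 : ℝ) * Real.exp (-(1 / 8) * ε ^ (-2 : ℤ))) := by
  have h2 := hY.memLp_uncurry_of_neumannKernel hK
  have hm := (IsCenteredGaussianOnUnit.integrable_sqNorm h2).aestronglyMeasurable.aemeasurable
  have hp := isProbabilityMeasure_map_sqNorm h2
  have h := isEquivalent_cdf (ae_nonneg_map_sqNorm hm) (integral_exp_map_sqNorm hY hK)
  have hsq : Tendsto (fun ε : ℝ => ε ^ 2) (𝓝[>] 0) (𝓝[>] 0) := by
    refine tendsto_nhdsWithin_iff.2 ⟨?_, ?_⟩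
    · have : Tendsto (fun ε : ℝ => ε ^ 2) (𝓝 0) (𝓝 (0 ^ 2)) := Continuous.tendsto (by fun_prop) 0
      rw [zero_pow two_ne_zero] at this
      exact this.mono_left nhdsWithin_le_nhds
    · filter_upwards [self_mem_nhdsWithin] with ε hε
      exact pow_pos (mem_Ioi.1 hε) 2
  refine ((h.comp_tendsto hsq).congr_left ?_).congr_right ?_
  · filter_upwards [self_mem_nhdsWithin] with ε hε
    exact (measureReal_pathNorm_le hm (le_of_lt hε)).symm
  · refine Eventually.of_forall fun ε => ?_
    simp only [Function.comp_apply]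
    rw [Real.sqrt_eq_rpow]
    congr 2
    rw [zpow_neg]
    norm_cast
    rw [one_div, mul_inv, neg_mul, one_div]

end Main

theorem mainTheorem2 (α : ℝ) (hα : α ≠ -1)
    {Ω : Type*} [MeasurableSpace Ω] (P : Measure Ω) [IsProbabilityMeasure P]
    (X : ℝ → Ω → ℝ) (hX : IsCenteredGaussianOnUnit X P)
    (hG : IsGreenFunction (twistedConditions α) (covKernel X P)) :
    -- almost every sample path is square integrable, so the objects below are well defined
    (∀ᵐ ω ∂P, MemLp (fun t => X t ω) 2 (volume.restrict (Icc (0 : ℝ) 1))) ∧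
    -- the demeaned process is the Green Gaussian process of the Neumann problem
    IsCenteredGaussianOnUnit (demean X) P ∧
    IsGeneralizedGreenFunction neumannConditions (covKernel (demean X) P) ∧
    -- equality in law with the norm of the demeaned Wiener process
    (∀ {Ω' : Type*} [MeasurableSpace Ω'] (P' : Measure Ω') [IsProbabilityMeasure P']
      (W : NNReal → Ω' → ℝ), IsBrownianReal W P' →
      IdentDistrib (pathNorm (demean X)) (pathNorm (demean (onUnit W))) P P' ∧
      ∀ ε : ℝ, P.real {ω | pathNorm (demean X) ω ≤ ε} =
        P'.real {ω | pathNorm (demean (onUnit W)) ω ≤ ε}) ∧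
    -- small ball asymptotics
    (fun ε : ℝ => P.real {ω | pathNorm (demean X) ω ≤ ε}) ~[𝓝[>] 0]
      (fun ε : ℝ => (8 / Real.pi) ^ (1 / 2 : ℝ) * Real.exp (-(1 / 8) * ε ^ (-2 : ℤ))) := by
  have h2 := hX.memLp_uncurry hG.continuousOn
  have hY := hX.demean h2
  have hK := hX.covKernel_demean h2 (hG.twisted_eq hα)
  refine ⟨IsCenteredGaussianOnUnit.ae_memLp_path h2, hY, isGeneralizedGreenFunction_neumann hK,
    fun {Ω'} _ P' _ W hW => ?_, isEquivalent_measureReal_pathNorm_le hY hK⟩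
  have hWX := isCenteredGaussianOnUnit_onUnit hW
  have hWK := covKernel_onUnit hW
  have hW2 := hWX.memLp_uncurry (ContinuousOn.congr (f := fun p : ℝ × ℝ => min p.1 p.2)
    (by fun_prop) fun p hp => hWK p.1 hp.1 p.2 hp.2)
  have hWY := hWX.demean hW2
  -- The Wiener covariance `min t s` is the member `c = 0` of the same family.
  have hWYK := hWX.covKernel_demean hW2 (c := 0) fun t ht s hs => by simp [hWK t ht s hs]
  have hid : IdentDistrib (pathNorm (demean X)) (pathNorm (demean (onUnit W))) P P' :=
    (identDistrib_sqNorm hY hK hWY hWYK).comp Real.continuous_sqrt.measurable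
  refine ⟨hid, fun ε => ?_⟩
  rw [measureReal_def, measureReal_def]
  exact congrArg ENNReal.toReal (hid.measure_mem_eq (s := Iic ε) measurableSet_Iic)
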